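/- Let $\nu,k,\alpha$ be nonzero real constants and consider the system $$U_x+V_y=0,\qquad U U_x+V V_y=P P_x+\nu U_{yy}+\frac{\nu}{k}(P-U),\qquad U T_x+V T_y=\alpha T_{yy}\tag{1}$$ for smooth functions $U,V,P,T$ of $(x,y)$. Write $u=(u^1,u^2,u^3,u^4)=(U,V,P,T)$ and $(x_1,x_2)=(x,y)$. Let $\Omega$ be a nonempty connected open subset of the total space $\mathbb R^6$ with coordinates $(x,y,U,V,P,T)$ (for example $\Omega=\mathbb R^6$). For a smooth vector field $$\mathbf v=\sum_{i=1}^2\xi_i\,\partial_{x_i}+\sum_{\beta=1}^4\varphi_\beta\,\partial_{u^\beta}$$ on $\Omega$, with coefficients depending on $(x,y,U,V,P,T)$, let $$\mathbf v^{(2)}=\sum_i\xi_i\,\partial_{x_i}+\sum_\beta\sum_{|J|\le 2}\varphi^J_\beta\,\partial_{u^\beta_J},\qquad \varphi^J_\beta=D_J\Big(\varphi_\beta-\sum_i\xi_i u^\beta_i\Big)+\sum_i\xi_i u^\beta_{J,i},$$ be its second prolongation, where $D_J$ denotes iterated total derivatives. Call $\mathbf v$ an infinitesimal point symmetry of (1)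 on $\Omega$ if $\mathbf v^{(2)}$ annihilates the difference of the two sides of each of the three equations of (1) at every jet over $\Omega$ that satisfies (1). Then the infinitesimal point symmetries of (1) on $\Omega$ form a Lie subalgebra $\mathfrak g$ of the Lie algebra of smooth vector fields on $\Omega$. It has dimension four, and the (restrictions to $\Omega$ of the) vector fields $$\mathbf v_1=\partial_x,\qquad \mathbf v_2=\partial_y,\qquad \mathbf v_3=\partial_T,\qquad \mathbf v_4=T\,\partial_T$$ form a basis of it. Their brackets are $[\mathbf v_3,\mathbf v_4]=\mathbf v_3$ and $[\mathbf v_i,\mathbf v_j]=0$ for all other pairs $i<j$. Moreover, the same Lie algebra $\mathfrak g$ is obtained if the annihilation is required only at those jets over $\Omega$ that satisfy (1) together with the two differential consequences $U_{xx}+V_{xy}=0$ and $U_{xy}+V_{yy}=0$ of the first equation. -/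

import Mathlib

open scoped ContDiff

noncomputable section

namespace StagnationFlow

/-- The total space of the system, with coordinates `(x, y)` (independent variables, indices
`0, 1` of the first factor) and `(U, V, P, T)` (dependent variables, indices `0, 1, 2, 3` of the
second factor). -/
abbrev Total : Type := (Fin 2 → ℝ) × (Fin 4 → ℝ)

/-- The space of jets of functions `(U, V, P, T)` of `(x, y)`. For `j : Jet`, `j.1` is the base
point `(x, y)`, and `j.2 β (a, b)` is the coordinate `∂ₓᵃ ∂ᵧᵇ u^β`, with `u = (U, V, P, T)`. -/
abbrev Jet : Type := (Fin 2 → ℝ) × (Fin 4 → ℕ × ℕ → ℝ)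

/-- The projection of a jet to the total space. -/
def Jet.point (j : Jet) : Total := (j.1, fun β => j.2 β (0, 0))

/-- The multi-index of the first derivative with respect to the `i`-th independent variable. -/
def unitIndex (i : Fin 2) : ℕ × ℕ := if i = 0 then (1, 0) else (0, 1)

/-- The partial derivative of `F` with respect to the independent variable `x_i`. -/
def partialX (i : Fin 2) (F : Jet → ℝ) (j : Jet) : ℝ :=
  deriv (fun s : ℝ => F (Function.update j.1 i s, j.2)) (j.1 i)

/-- The partial derivative of `F` with respect to the jet coordinate `u^β_J`. -/
def partialU (β : Fin 4) (J : ℕ × ℕ) (F : Jet → ℝ) (j : Jet) : ℝ :=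
  deriv (fun s : ℝ => F (j.1, Function.update j.2 β (Function.update (j.2 β) J s))) (j.2 β J)

/-- The total derivative `D_i = ∂/∂x_i + ∑_β ∑_J u^β_{J,i} ∂/∂u^β_J`. It is applied only to
functions that depend on finitely many jet coordinates, so that the sum over `J` is finite. -/
def totalD (i : Fin 2) (F : Jet → ℝ) (j : Jet) : ℝ :=
  partialX i F j + ∑ β : Fin 4, ∑ᶠ J : ℕ × ℕ, j.2 β (J + unitIndex i) * partialU β J F j

/-- The iterated total derivative `D_J = D_xᵃ D_yᵇ` for `J = (a, b)`. -/
def totalDMulti (J : ℕ × ℕ) (F : Jet → ℝ) : Jet → ℝ :=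
  (totalD 0)^[J.1] ((totalD 1)^[J.2] F)

/-- The characteristic `Q^β = φ_β - ∑_i ξ_i u^β_i` of the vector field `X = (ξ, φ)`. -/
def characteristic (X : Total → Total) (β : Fin 4) (j : Jet) : ℝ :=
  (X j.point).2 β - ∑ i : Fin 2, (X j.point).1 i * j.2 β (unitIndex i)

/-- The coefficient `φ^J_β = D_J Q^β + ∑_i ξ_i u^β_{J,i}` of the prolongation of `X`. -/
def prolongCoeff (X : Total → Total) (β : Fin 4) (J : ℕ × ℕ) (j : Jet) : ℝ :=
  totalDMulti J (characteristic X β) j + ∑ i : Fin 2, (X j.point).1 i * j.2 β (J + unitIndex i)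

/-- The multi-indices `J` with `|J| ≤ 2`. -/
def indicesTwo : Finset (ℕ × ℕ) := {(0, 0), (1, 0), (0, 1), (2, 0), (1, 1), (0, 2)}

/-- The second prolongation of the vector field `X`, applied to a function `F` on jets. -/
def prolongTwo (X : Total → Total) (F : Jet → ℝ) (j : Jet) : ℝ :=
  ∑ i : Fin 2, (X j.point).1 i * partialX i F j +
    ∑ β : Fin 4, ∑ J ∈ indicesTwo, prolongCoeff X β J j * partialU β J F j

/-- The continuity equation `U_x + V_y = 0`, written as left side minus right side. -/
def continuityEq (j : Jet) : ℝ := j.2 0 (1, 0) + j.2 1 (0, 1)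

/-- The momentum equation `U U_x + V V_y = P P_x + ν U_yy + (ν / k) (P - U)`, written as left
side minus right side. -/
def momentumEq (ν k : ℝ) (j : Jet) : ℝ :=
  j.2 0 (0, 0) * j.2 0 (1, 0) + j.2 1 (0, 0) * j.2 1 (0, 1) -
    (j.2 2 (0, 0) * j.2 2 (1, 0) + ν * j.2 0 (0, 2) + ν / k * (j.2 2 (0, 0) - j.2 0 (0, 0)))

/-- The heat equation `U T_x + V T_y = α T_yy`, written as left side minus right side. -/
def heatEq (α : ℝ) (j : Jet) : ℝ :=
  j.2 0 (0, 0) * j.2 3 (1, 0) + j.2 1 (0, 0) * j.2 3 (0, 1) - α * j.2 3 (0, 2)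

/-- The jets that satisfy the three equations of the system. -/
def systemJets (ν k α : ℝ) : Set Jet :=
  {j | continuityEq j = 0 ∧ momentumEq ν k j = 0 ∧ heatEq α j = 0}

/-- The jets that satisfy the three equations of the system and also the first total derivatives
of the continuity equation (the other equations being of second order, these are the remaining
differential consequences of the system of order at most two). -/
def prolongedSystemJets (ν k α : ℝ) : Set Jet :=
  {j | j ∈ systemJets ν k α ∧ ∀ i : Fin 2, totalD i continuityEq j = 0}

/-- The invariance condition for a vector field `X` on `Ω`: the second prolongation of `X`
annihilates the three equations at all jets of `S` over `Ω`. -/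
def IsInvariantMod (ν k α : ℝ) (S : Set Jet) (Ω : Set Total) (X : Total → Total) : Prop :=
  ∀ j ∈ S, j.point ∈ Ω →
    prolongTwo X continuityEq j = 0 ∧ prolongTwo X (momentumEq ν k) j = 0 ∧
      prolongTwo X (heatEq α) j = 0

/-- The smooth vector fields on an open subset `Ω` of the total space. A vector field on `Ω` is
represented by its extension by zero. -/
def VectorFields (Ω : TopologicalSpace.Opens Total) : Submodule ℝ (Total → Total) where
  carrier := {X | ContDiffOn ℝ ∞ X Ω ∧ ∀ z ∉ Ω, X z = 0}
  zero_mem' := ⟨contDiffOn_const, fun _ _ => rfl⟩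
  add_mem' := by
    rintro X Y ⟨hX, hX0⟩ ⟨hY, hY0⟩
    exact ⟨hX.add hY, fun z hz => by simp [hX0 z hz, hY0 z hz]⟩
  smul_mem' := by
    rintro c X ⟨hX, hX0⟩
    exact ⟨contDiffOn_const.smul hX, fun z hz => by simp [hX0 z hz]⟩

open Classical in
/-- The restriction to `Ω` of a smooth vector field on the total space. -/
def restrict (Ω : TopologicalSpace.Opens Total) (X : Total → Total) (hX : ContDiff ℝ ∞ X) :
    VectorFields Ω :=
  ⟨(Ω : Set Total).indicator X,
    (hX.contDiffOn (s := (Ω : Set Total))).congr fun _ hz => Set.indicator_of_mem hz X,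
    fun _ hz => Set.indicator_of_notMem hz X⟩

section Bracket

variable {Ω : TopologicalSpace.Opens Total}

theorem contDiffAt_field (X : VectorFields Ω) {z : Total} (hz : z ∈ Ω) :
    ContDiffAt ℝ ∞ X.1 z :=
  X.2.1.contDiffAt (Ω.isOpen.mem_nhds hz)

theorem differentiableAt_field (X : VectorFields Ω) {z : Total} (hz : z ∈ Ω) :
    DifferentiableAt ℝ X.1 z :=
  (contDiffAt_field X hz).differentiableAt (by simp)

theorem contDiffOn_lieBracket (X Y : VectorFields Ω) :
    ContDiffOn ℝ ∞ (VectorField.lieBracket ℝ X.1 Y.1) Ω := by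
  intro z hz
  exact ((contDiffAt_field X hz).lieBracket_vectorField (contDiffAt_field Y hz)
    (m := ∞) (by simp)).contDiffWithinAt

open Classical in
/-- The Lie bracket of vector fields: `[X, Y] f = X (Y f) - Y (X f)`. -/
instance : Bracket (VectorFields Ω) (VectorFields Ω) where
  bracket X Y := ⟨(Ω : Set Total).indicator (VectorField.lieBracket ℝ X.1 Y.1),
    (contDiffOn_lieBracket X Y).congr fun _ hz => Set.indicator_of_mem hz _,
    fun _ hz => Set.indicator_of_notMem hz _⟩

theorem bracket_apply (X Y : VectorFields Ω) {z : Total} (hz : z ∈ Ω) :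
    (⁅X, Y⁆ : VectorFields Ω).1 z = VectorField.lieBracket ℝ X.1 Y.1 z :=
  Set.indicator_of_mem (s := (Ω : Set Total)) hz _

theorem bracket_eventuallyEq (X Y : VectorFields Ω) {z : Total} (hz : z ∈ Ω) :
    (⁅X, Y⁆ : VectorFields Ω).1 =ᶠ[nhds z] VectorField.lieBracket ℝ X.1 Y.1 :=
  Filter.eventually_of_mem (Ω.isOpen.mem_nhds hz) fun _ hw => bracket_apply X Y hw

theorem field_ext_on {X Y : VectorFields Ω} (h : ∀ z ∈ Ω, X.1 z = Y.1 z) : X = Y := by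
  apply Subtype.ext
  funext z
  by_cases hz : z ∈ Ω
  · exact h z hz
  · rw [X.2.2 z hz, Y.2.2 z hz]

instance : LieRing (VectorFields Ω) where
  add_lie X Y Z := field_ext_on fun z hz => by
    change _ = (⁅X, Z⁆ : VectorFields Ω).1 z + (⁅Y, Z⁆ : VectorFields Ω).1 z
    rw [bracket_apply _ _ hz, bracket_apply _ _ hz, bracket_apply _ _ hz]
    exact VectorField.lieBracket_add_left (differentiableAt_field X hz) (differentiableAt_field Y hz)
  lie_add X Y Z := field_ext_on fun z hz => by
    change _ = (⁅X, Y⁆ : VectorFields Ω).1 z + (⁅X, Z⁆ : VectorFields Ω).1 z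
    rw [bracket_apply _ _ hz, bracket_apply _ _ hz, bracket_apply _ _ hz]
    exact VectorField.lieBracket_add_right (differentiableAt_field Y hz) (differentiableAt_field Z hz)
  lie_self X := field_ext_on fun z hz => by
    rw [bracket_apply _ _ hz]
    simp
  leibniz_lie X Y Z := field_ext_on fun z hz => by
    change _ = (⁅⁅X, Y⁆, Z⁆ : VectorFields Ω).1 z + (⁅Y, ⁅X, Z⁆⁆ : VectorFields Ω).1 z
    rw [bracket_apply _ _ hz, bracket_apply _ _ hz, bracket_apply _ _ hz,
      Filter.EventuallyEq.lieBracket_vectorField_eq Filter.EventuallyEq.rfl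
        (bracket_eventuallyEq Y Z hz),
      Filter.EventuallyEq.lieBracket_vectorField_eq (bracket_eventuallyEq X Y hz)
        Filter.EventuallyEq.rfl,
      Filter.EventuallyEq.lieBracket_vectorField_eq Filter.EventuallyEq.rfl
        (bracket_eventuallyEq X Z hz)]
    exact VectorField.leibniz_identity_lieBracket (n := ∞)
      (by simpa using (ENat.LEInfty.out : (2 : WithTop ℕ∞) ≤ ∞))
      (contDiffAt_field X hz) (contDiffAt_field Y hz) (contDiffAt_field Z hz)

instance : LieAlgebra ℝ (VectorFields Ω) where
  lie_smul c X Y := field_ext_on fun z hz => by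
    change _ = c • (⁅X, Y⁆ : VectorFields Ω).1 z
    rw [bracket_apply _ _ hz, bracket_apply _ _ hz]
    exact VectorField.lieBracket_const_smul_right (differentiableAt_field Y hz)

end Bracket

/-- The vector fields `∂/∂x`, `∂/∂y`, `∂/∂T` and `T ∂/∂T` on the total space. -/
def generator : Fin 4 → Total → Total :=
  ![fun _ => (Pi.single 0 1, 0), fun _ => (Pi.single 1 1, 0), fun _ => (0, Pi.single 3 1),
    fun z => (0, Pi.single 3 (z.2 3))]

theorem contDiff_generator (i : Fin 4) : ContDiff ℝ ∞ (generator i) := by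
  fin_cases i
  · exact contDiff_const
  · exact contDiff_const
  · exact contDiff_const
  · change ContDiff ℝ ∞ fun z : Total => ((0 : Fin 2 → ℝ), (Pi.single 3 (z.2 3) : Fin 4 → ℝ))
    refine contDiff_const.prodMk (contDiff_pi.2 fun β => ?_)
    by_cases h : β = 3
    · subst h
      simp only [Pi.single_eq_same]
      fun_prop
    · simp only [Pi.single_eq_of_ne h]
      exact contDiff_const

/-- The restrictions to `Ω` of `∂/∂x`, `∂/∂y`, `∂/∂T` and `T ∂/∂T`. -/
def generatorOn (Ω : TopologicalSpace.Opens Total) (i : Fin 4) : VectorFields Ω :=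
  restrict Ω (generator i) (contDiff_generator i)

end StagnationFlow

end

/-!
Invariance at all jets of the system implies invariance at those that also satisfy the derivatives
of the continuity equation, so two inclusions give both descriptions of the symmetry algebra: a
field that is invariant at the latter jets is a combination of the four generators, and each such
combination is invariant at all jets of the system. The second is a direct computation
(`isInvariantMod_sum_generatorOn`).

For the first, `totalD` is a derivation on the functions of finitely many jet coordinates
(`totalD_add`, `totalD_mul`), which gives the usual formulas for the prolongation coefficients
`φ^x`, `φ^y`, `φ^yy` (`prolongCoeff_unitIndex`, `prolongCoeff_yy`); no others occur. Over each point
the derivatives `U_x, U_y, V_x, P_x, P_y, T_x, T_y, U_xy, P_yy` can be prescribed freely, and `V_y`,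
`V_yy`, `U_yy`, `T_yy` are solved for (`solvedJet`). The invariance conditions are therefore
polynomial identities in the free derivatives, whose coefficients are the determining equations.

The continuity condition makes `ξ`, `η`, `φU`, `φV` independent of `P` and `T`. The `U_xy`
coefficient of the momentum condition, where `V_yy = -U_xy`, then gives `ξ = ξ(x)`. On the set where
`P ≠ 0` the other coefficients give `η = η(y)`, and the heat condition gives `φT = φT(T)`, affine in
`T`, together with `φU = U (ξ_x - 2 η_y)` and `φV = -V η_y - α η_yy`. By the continuity condition
`ξ_x` and `η_y` are locally constant, and the rest of the momentum condition forces both of them and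
`φP` to vanish (`DeterminingEqs.scaling_eq_zero`). Since `P ≠ 0` is dense in the connected set `Ω`,
the identities extend to `Ω` and integrate to constants (`exists_eq_sum_of_isInvariantMod`).
-/

namespace StagnationFlow

/-! ### Total derivatives -/

/-- The directional derivative along `v` of a function on the total space. -/
noncomputable def pd (v : Total) (f : Total → ℝ) (z : Total) : ℝ := fderiv ℝ f z v

/-- The coordinate vector `∂/∂x_i`. -/
def eX (i : Fin 2) : Total := (Pi.single i 1, 0)

/-- The coordinate vector `∂/∂u^β`. -/
def eU (β : Fin 4) : Total := (0, Pi.single β 1)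

/-- The functions on jets that are differentiable in each jet coordinate at `j`, with only finitely
many nonzero partial derivatives. On these, `totalD` is a derivation. -/
structure JetDifferentiableAt (F : Jet → ℝ) (j : Jet) : Prop where
  x : ∀ i, DifferentiableAt ℝ (fun s : ℝ => F (Function.update j.1 i s, j.2)) (j.1 i)
  u : ∀ β J, DifferentiableAt ℝ
    (fun s : ℝ => F (j.1, Function.update j.2 β (Function.update (j.2 β) J s))) (j.2 β J)
  finite : ∀ β, (Function.support fun J => partialU β J F j).Finite

section Rules

variable {F G : Jet → ℝ} {j : Jet}

theorem partialX_add (hF : JetDifferentiableAt F j) (hG : JetDifferentiableAt G j) (i : Fin 2) :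
    partialX i (fun j => F j + G j) j = partialX i F j + partialX i G j :=
  deriv_fun_add (hF.x i) (hG.x i)

theorem partialU_add (hF : JetDifferentiableAt F j) (hG : JetDifferentiableAt G j) (β : Fin 4)
    (J : ℕ × ℕ) :
    partialU β J (fun j => F j + G j) j = partialU β J F j + partialU β J G j :=
  deriv_fun_add (hF.u β J) (hG.u β J)

theorem partialX_mul (hF : JetDifferentiableAt F j) (hG : JetDifferentiableAt G j) (i : Fin 2) :
    partialX i (fun j => F j * G j) j = partialX i F j * G j + F j * partialX i G j := by
  simpa [partialX] using deriv_fun_mul (hF.x i) (hG.x i)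

theorem partialU_mul (hF : JetDifferentiableAt F j) (hG : JetDifferentiableAt G j) (β : Fin 4)
    (J : ℕ × ℕ) :
    partialU β J (fun j => F j * G j) j = partialU β J F j * G j + F j * partialU β J G j := by
  simpa [partialU] using deriv_fun_mul (hF.u β J) (hG.u β J)

theorem JetDifferentiableAt.add (hF : JetDifferentiableAt F j) (hG : JetDifferentiableAt G j) :
    JetDifferentiableAt (fun j => F j + G j) j where
  x i := (hF.x i).fun_add (hG.x i)
  u β J := (hF.u β J).fun_add (hG.u β J)
  finite β := ((hF.finite β).union (hG.finite β)).subset <| by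
    simp only [partialU_add hF hG]
    exact Function.support_add _ _

theorem JetDifferentiableAt.mul (hF : JetDifferentiableAt F j) (hG : JetDifferentiableAt G j) :
    JetDifferentiableAt (fun j => F j * G j) j where
  x i := (hF.x i).fun_mul (hG.x i)
  u β J := (hF.u β J).fun_mul (hG.u β J)
  finite β := ((hF.finite β).union (hG.finite β)).subset <| by
    intro J hJ
    simp only [partialU_mul hF hG, Function.mem_support] at hJ
    by_contra h
    simp only [Set.mem_union, Function.mem_support, not_or, not_not] at h
    simp [h] at hJ

theorem totalD_add (hF : JetDifferentiableAt F j) (hG : JetDifferentiableAt G j) (i : Fin 2) :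
    totalD i (fun j => F j + G j) j = totalD i F j + totalD i G j := by
  have hfin {H : Jet → ℝ} (hH : JetDifferentiableAt H j) (β : Fin 4) :
      (Function.support fun J => j.2 β (J + unitIndex i) * partialU β J H j).Finite :=
    (hH.finite β).subset (Function.support_mul_subset_right _ _)
  simp only [totalD, partialX_add hF hG, partialU_add hF hG, mul_add]
  simp only [finsum_add_distrib (hfin hF _) (hfin hG _), Finset.sum_add_distrib]
  ring

theorem totalD_mul (hF : JetDifferentiableAt F j) (hG : JetDifferentiableAt G j) (i : Fin 2) :
    totalD i (fun j => F j * G j) j = totalD i F j * G j + F j * totalD i G j := by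
  have hfin {H : Jet → ℝ} (hH : JetDifferentiableAt H j) (β : Fin 4) :
      (Function.support fun J => j.2 β (J + unitIndex i) * partialU β J H j).Finite :=
    (hH.finite β).subset (Function.support_mul_subset_right _ _)
  have key (β : Fin 4) : ∑ᶠ J : ℕ × ℕ, j.2 β (J + unitIndex i) *
      (partialU β J F j * G j + F j * partialU β J G j) =
      (∑ᶠ J : ℕ × ℕ, j.2 β (J + unitIndex i) * partialU β J F j) * G j +
        F j * ∑ᶠ J : ℕ × ℕ, j.2 β (J + unitIndex i) * partialU β J G j := by
    rw [finsum_mul, mul_finsum, ← finsum_add_distrib]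
    · exact finsum_congr fun J => by ring
    · exact (hfin hF β).subset (Function.support_mul_subset_left _ _)
    · exact (hfin hG β).subset (Function.support_mul_subset_right _ _)
  simp only [totalD, partialX_mul hF hG, partialU_mul hF hG, key, Finset.sum_add_distrib,
    ← Finset.sum_mul, ← Finset.mul_sum]
  ring

theorem partialU_coord (β γ : Fin 4) (J K : ℕ × ℕ) :
    partialU γ K (fun j => j.2 β J) j = if γ = β ∧ K = J then 1 else 0 := by
  by_cases hγ : γ = β
  · subst hγ
    by_cases hK : K = J
    · subst hK
      simp [partialU]
    · simp [partialU, hK, Function.update_of_ne (Ne.symm hK)]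
  · simp [partialU, hγ, Function.update_of_ne (Ne.symm hγ)]

theorem jetDifferentiableAt_coord (β : Fin 4) (J : ℕ × ℕ) :
    JetDifferentiableAt (fun j => j.2 β J) j where
  x i := by simp
  u γ K := by
    by_cases hγ : γ = β
    · subst hγ
      by_cases hK : K = J
      · subst hK
        simp
      · simp [Function.update_of_ne (Ne.symm hK)]
    · simp [Function.update_of_ne (Ne.symm hγ)]
  finite γ := (Set.finite_singleton J).subset fun K hK => by
    by_contra h
    simp only [Set.mem_singleton_iff] at h
    simp [partialU_coord, h] at hK

theorem totalD_coord (i : Fin 2) (β : Fin 4) (J : ℕ × ℕ) :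
    totalD i (fun j => j.2 β J) j = j.2 β (J + unitIndex i) := by
  have h (γ : Fin 4) : ∑ᶠ K : ℕ × ℕ, j.2 γ (K + unitIndex i) *
      partialU γ K (fun j => j.2 β J) j = if γ = β then j.2 γ (J + unitIndex i) else 0 := by
    rw [finsum_eq_single _ J fun K hK => by simp [partialU_coord, hK]]
    simp [partialU_coord]
  simp [totalD, h, partialX]

theorem hasDerivAt_point_x {f : Total → ℝ} (hf : DifferentiableAt ℝ f j.point) (i : Fin 2) :
    HasDerivAt (fun s : ℝ => f (Jet.point (Function.update j.1 i s, j.2)))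
      (pd (eX i) f j.point) (j.1 i) := by
  have h : HasDerivAt (fun s : ℝ => Jet.point (Function.update j.1 i s, j.2)) (eX i) (j.1 i) :=
    (hasDerivAt_update j.1 i (j.1 i)).prodMk (hasDerivAt_const (j.1 i) j.point.2)
  have e : Jet.point (Function.update j.1 i (j.1 i), j.2) = j.point := by simp [Jet.point]
  have hf' := hf.hasFDerivAt
  rw [← e] at hf'
  simpa [pd, e, Function.comp_def] using hf'.comp_hasDerivAt (j.1 i) h

theorem hasDerivAt_point_u {f : Total → ℝ} (hf : DifferentiableAt ℝ f j.point) (β : Fin 4)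
    (J : ℕ × ℕ) :
    HasDerivAt (fun s : ℝ =>
        f (Jet.point (j.1, Function.update j.2 β (Function.update (j.2 β) J s))))
      (if J = (0, 0) then pd (eU β) f j.point else 0) (j.2 β J) := by
  have e : Jet.point (j.1, Function.update j.2 β (Function.update (j.2 β) J (j.2 β J))) =
      j.point := by simp [Jet.point]
  have hf' := hf.hasFDerivAt
  split_ifs with hJ
  · subst hJ
    have h : HasDerivAt (fun s : ℝ =>
        Jet.point (j.1, Function.update j.2 β (Function.update (j.2 β) (0, 0) s)))
        (eU β) (j.2 β (0, 0)) := by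
      have h2 : (fun s : ℝ =>
          Jet.point (j.1, Function.update j.2 β (Function.update (j.2 β) (0, 0) s))) =
          fun s => (j.1, Function.update j.point.2 β s) := by
        funext s
        refine Prod.ext rfl (funext fun γ => ?_)
        by_cases hγ : γ = β
        · subst hγ
          simp [Jet.point]
        · simp [Jet.point, hγ]
      rw [h2]
      exact (hasDerivAt_const _ _).prodMk (hasDerivAt_update j.point.2 β _)
    rw [← e] at hf'
    simpa [pd, e, Function.comp_def] using hf'.comp_hasDerivAt _ h
  · have h2 : (fun s : ℝ =>
        f (Jet.point (j.1, Function.update j.2 β (Function.update (j.2 β) J s)))) =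
        fun _ => f j.point := by
      funext s
      congr 1
      refine Prod.ext rfl (funext fun γ => ?_)
      by_cases hγ : γ = β
      · subst hγ
        simp [Jet.point, Function.update_of_ne (Ne.symm hJ)]
      · simp [Jet.point, hγ]
    rw [h2]
    exact hasDerivAt_const _ _

theorem jetDifferentiableAt_point {f : Total → ℝ} (hf : DifferentiableAt ℝ f j.point) :
    JetDifferentiableAt (fun j => f j.point) j where
  x i := (hasDerivAt_point_x hf i).differentiableAt
  u β J := (hasDerivAt_point_u hf β J).differentiableAt
  finite β := (Set.finite_singleton (0, 0)).subset fun J hJ => by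
    by_contra h
    simp only [Set.mem_singleton_iff] at h
    exact hJ ((hasDerivAt_point_u hf β J).deriv.trans (if_neg h))

/-- The total derivative of a function on the total space, as a function on jets. -/
noncomputable def baseD (i : Fin 2) (f : Total → ℝ) (j : Jet) : ℝ :=
  pd (eX i) f j.point + ∑ γ : Fin 4, j.2 γ (unitIndex i) * pd (eU γ) f j.point

theorem totalD_point {f : Total → ℝ} (hf : DifferentiableAt ℝ f j.point) (i : Fin 2) :
    totalD i (fun j => f j.point) j = baseD i f j := by
  have hu (β : Fin 4) (J : ℕ × ℕ) : partialU β J (fun j => f j.point) j =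
      if J = (0, 0) then pd (eU β) f j.point else 0 := (hasDerivAt_point_u hf β J).deriv
  have hx : partialX i (fun j => f j.point) j = pd (eX i) f j.point :=
    (hasDerivAt_point_x hf i).deriv
  rw [totalD, baseD, hx]
  congr 1
  refine Finset.sum_congr rfl fun β _ => ?_
  rw [finsum_eq_single _ (0, 0) fun K hK => by simp [hu, hK]]
  rw [hu, if_pos rfl, show ((0, 0) : ℕ × ℕ) + unitIndex i = unitIndex i from zero_add _]

/-- `F` has the total derivative `d` with respect to `x_i` at the jet `j`. -/
def HasTotalD (i : Fin 2) (F : Jet → ℝ) (d : ℝ) (j : Jet) : Prop :=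
  JetDifferentiableAt F j ∧ totalD i F j = d

theorem HasTotalD.add {i : Fin 2} {d e : ℝ} (hF : HasTotalD i F d j) (hG : HasTotalD i G e j) :
    HasTotalD i (fun j => F j + G j) (d + e) j :=
  ⟨hF.1.add hG.1, by rw [totalD_add hF.1 hG.1, hF.2, hG.2]⟩

theorem HasTotalD.mul {i : Fin 2} {d e : ℝ} (hF : HasTotalD i F d j) (hG : HasTotalD i G e j) :
    HasTotalD i (fun j => F j * G j) (d * G j + F j * e) j :=
  ⟨hF.1.mul hG.1, by rw [totalD_mul hF.1 hG.1, hF.2, hG.2]⟩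

theorem hasTotalD_coord (i : Fin 2) (β : Fin 4) (J : ℕ × ℕ) :
    HasTotalD i (fun j => j.2 β J) (j.2 β (J + unitIndex i)) j :=
  ⟨jetDifferentiableAt_coord β J, totalD_coord i β J⟩

theorem hasTotalD_point {f : Total → ℝ} (hf : DifferentiableAt ℝ f j.point) (i : Fin 2) :
    HasTotalD i (fun j => f j.point) (baseD i f j) j :=
  ⟨jetDifferentiableAt_point hf, totalD_point hf i⟩

/-- Total derivatives are local over the total space. -/
theorem totalD_congr {Ω : Set Total} (hΩ : IsOpen Ω) (hj : j.point ∈ Ω)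
    (h : ∀ j : Jet, j.point ∈ Ω → F j = G j) (i : Fin 2) : totalD i F j = totalD i G j := by
  have hx : partialX i F j = partialX i G j := by
    refine Filter.EventuallyEq.deriv_eq ?_
    have hc : Continuous fun s : ℝ => Jet.point (Function.update j.1 i s, j.2) :=
      Continuous.prodMk (f := fun s : ℝ => Function.update j.1 i s)
        (continuous_const.update i continuous_id) (continuous_const (y := j.point.2))
    have : ∀ᶠ s in nhds (j.1 i), Jet.point (Function.update j.1 i s, j.2) ∈ Ω :=
      hc.continuousAt.preimage_mem_nhds (hΩ.mem_nhds (by simpa [Jet.point] using hj))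
    exact this.mono fun s hs => h _ hs
  have hu (β : Fin 4) (J : ℕ × ℕ) : partialU β J F j = partialU β J G j := by
    refine Filter.EventuallyEq.deriv_eq ?_
    have hc : Continuous fun s : ℝ =>
        Jet.point (j.1, Function.update j.2 β (Function.update (j.2 β) J s)) := by
      refine continuous_const.prodMk (continuous_pi fun γ => ?_)
      exact (continuous_apply (0, 0)).comp ((continuous_apply γ).comp
        (continuous_const.update β (continuous_const.update J continuous_id)))
    have : ∀ᶠ s in nhds (j.2 β J),
        Jet.point (j.1, Function.update j.2 β (Function.update (j.2 β) J s)) ∈ Ω :=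
      hc.continuousAt.preimage_mem_nhds (hΩ.mem_nhds (by simpa [Jet.point] using hj))
    exact this.mono fun s hs => h _ hs
  simp only [totalD, hx, hu]

end Rules

/-! ### Prolongation coefficients -/

theorem contDiffOn_pd {Ω : Set Total} (hΩ : IsOpen Ω) {f : Total → ℝ} (hf : ContDiffOn ℝ ∞ f Ω)
    (v : Total) : ContDiffOn ℝ ∞ (pd v f) Ω :=
  (hf.fderiv_of_isOpen hΩ (by simp)).clm_apply contDiffOn_const

theorem differentiableAt_of_contDiffOn {Ω : Set Total} (hΩ : IsOpen Ω) {f : Total → ℝ}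
    (hf : ContDiffOn ℝ ∞ f Ω) {z : Total} (hz : z ∈ Ω) : DifferentiableAt ℝ f z :=
  (hf.contDiffAt (hΩ.mem_nhds hz)).differentiableAt (by simp)

theorem pd_neg (v : Total) (f : Total → ℝ) (z : Total) :
    pd v (fun z => -f z) z = -pd v f z := by
  simp [pd]

theorem baseD_neg (i : Fin 2) (f : Total → ℝ) (j : Jet) :
    baseD i (fun z => -f z) j = -baseD i f j := by
  simp only [baseD, pd_neg, Fin.sum_univ_four]
  ring

/-- The second total derivative `D_y D_y` of a function on the total space. -/
noncomputable def baseDyy (f : Total → ℝ) (j : Jet) : ℝ :=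
  baseD 1 (pd (eX 1) f) j +
    ∑ γ : Fin 4, (j.2 γ (0, 2) * pd (eU γ) f j.point + j.2 γ (0, 1) * baseD 1 (pd (eU γ) f) j)

theorem baseDyy_neg (f : Total → ℝ) (j : Jet) :
    baseDyy (fun z => -f z) j = -baseDyy f j := by
  have h (v : Total) : pd v (fun z => -f z) = fun z => -pd v f z := funext fun z => pd_neg v f z
  simp only [baseDyy, h, baseD_neg, Fin.sum_univ_four]
  ring

section

variable {Ω : Set Total} {j : Jet}

theorem hasTotalD_baseD (hΩ : IsOpen Ω) {f : Total → ℝ} (hf : ContDiffOn ℝ ∞ f Ω)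
    (hj : j.point ∈ Ω) : HasTotalD 1 (baseD 1 f) (baseDyy f j) j := by
  have hp (v : Total) : HasTotalD 1 (fun j => pd v f j.point) (baseD 1 (pd v f) j) j :=
    hasTotalD_point (differentiableAt_of_contDiffOn hΩ (contDiffOn_pd hΩ hf v) hj) 1
  have hu (γ : Fin 4) := (hasTotalD_coord (j := j) 1 γ (unitIndex 1)).mul (hp (eU γ))
  have h := (hp (eX 1)).add ((((hu 0).add (hu 1)).add (hu 2)).add (hu 3))
  simp only [← add_assoc] at h
  convert h using 1
  · funext j
    simp only [baseD, Fin.sum_univ_four, add_assoc]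
  · simp only [baseDyy, Fin.sum_univ_four, unitIndex, add_assoc]
    rfl

variable {X : Total → Total}

theorem contDiffOn_fst (hX : ContDiffOn ℝ ∞ X Ω) (k : Fin 2) :
    ContDiffOn ℝ ∞ (fun z => (X z).1 k) Ω :=
  contDiffOn_pi.1 hX.fst k

theorem contDiffOn_snd (hX : ContDiffOn ℝ ∞ X Ω) (β : Fin 4) :
    ContDiffOn ℝ ∞ (fun z => (X z).2 β) Ω :=
  contDiffOn_pi.1 hX.snd β

theorem hasTotalD_characteristic (hΩ : IsOpen Ω) (hX : ContDiffOn ℝ ∞ X Ω) (hj : j.point ∈ Ω)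
    (β : Fin 4) (i : Fin 2) :
    HasTotalD i (characteristic X β) (baseD i (fun z => (X z).2 β) j -
      ∑ k : Fin 2, (baseD i (fun z => (X z).1 k) j * j.2 β (unitIndex k) +
        (X j.point).1 k * j.2 β (unitIndex k + unitIndex i))) j := by
  have h1 := hasTotalD_point (differentiableAt_of_contDiffOn hΩ (contDiffOn_snd hX β) hj) i
  have h2 (k : Fin 2) := (hasTotalD_point
    (differentiableAt_of_contDiffOn hΩ (contDiffOn_fst hX k).neg hj) i).mul
      (hasTotalD_coord i β (unitIndex k))
  convert h1.add ((h2 0).add (h2 1)) using 1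
  · funext j
    simp only [characteristic, Fin.sum_univ_two]
    ring
  · simp only [baseD_neg, Fin.sum_univ_two]
    ring

theorem prolongCoeff_unitIndex (hΩ : IsOpen Ω) (hX : ContDiffOn ℝ ∞ X Ω) (hj : j.point ∈ Ω)
    (β : Fin 4) (i : Fin 2) :
    prolongCoeff X β (unitIndex i) j = baseD i (fun z => (X z).2 β) j -
      ∑ k : Fin 2, baseD i (fun z => (X z).1 k) j * j.2 β (unitIndex k) := by
  have h : totalDMulti (unitIndex i) (characteristic X β) = totalD i (characteristic X β) := by
    fin_cases i <;> rfl
  rw [prolongCoeff, h, (hasTotalD_characteristic hΩ hX hj β i).2]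
  simp only [Fin.sum_univ_two, add_comm (unitIndex i)]
  ring

/-- The formula for `φ^yy`; the third-order terms of `D_y D_y Q` cancel against `ξ_i u_{yy,i}`. -/
theorem prolongCoeff_yy (hΩ : IsOpen Ω) (hX : ContDiffOn ℝ ∞ X Ω) (hj : j.point ∈ Ω)
    (β : Fin 4) :
    prolongCoeff X β (0, 2) j = baseDyy (fun z => (X z).2 β) j -
      ∑ k : Fin 2, (baseDyy (fun z => (X z).1 k) j * j.2 β (unitIndex k) +
        2 * baseD 1 (fun z => (X z).1 k) j * j.2 β (unitIndex k + unitIndex 1)) := by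
  have h : totalDMulti (0, 2) (characteristic X β) =
    totalD 1 (totalD 1 (characteristic X β)) := rfl
  have h1 := hasTotalD_baseD hΩ (contDiffOn_snd hX β) hj
  have h2 (k : Fin 2) := ((hasTotalD_baseD hΩ (contDiffOn_fst hX k).neg hj).mul
      (hasTotalD_coord 1 β (unitIndex k))).add ((hasTotalD_point
    (differentiableAt_of_contDiffOn hΩ (contDiffOn_fst hX k).neg hj) 1).mul
      (hasTotalD_coord 1 β (unitIndex k + unitIndex 1)))
  rw [prolongCoeff, h, totalD_congr hΩ hj (G := fun j => baseD 1 (fun z => (X z).2 β) j +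
      ((baseD 1 (fun z => -(X z).1 0) j * j.2 β (unitIndex 0) +
          -(X j.point).1 0 * j.2 β (unitIndex 0 + unitIndex 1)) +
        (baseD 1 (fun z => -(X z).1 1) j * j.2 β (unitIndex 1) +
          -(X j.point).1 1 * j.2 β (unitIndex 1 + unitIndex 1)))) fun j hj => by
        rw [(hasTotalD_characteristic hΩ hX hj β 1).2]
        simp only [baseD_neg, Fin.sum_univ_two]
        ring,
    (h1.add ((h2 0).add (h2 1))).2]
  simp only [baseD_neg, baseDyy_neg, Fin.sum_univ_two]
  have e0 : ((0, 2) : ℕ × ℕ) + unitIndex 0 = unitIndex 0 + unitIndex 1 + unitIndex 1 := rfl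
  have e1 : ((0, 2) : ℕ × ℕ) + unitIndex 1 = unitIndex 1 + unitIndex 1 + unitIndex 1 := rfl
  rw [e0, e1]
  ring

end

/-! ### The prolonged field applied to the equations -/

theorem totalD_continuityEq (i : Fin 2) (j : Jet) : totalD i continuityEq j =
    j.2 0 ((1, 0) + unitIndex i) + j.2 1 ((0, 1) + unitIndex i) :=
  ((hasTotalD_coord i 0 (1, 0)).add (hasTotalD_coord i 1 (0, 1))).2

theorem prolongTwo_continuityEq (X : Total → Total) (j : Jet) :
    prolongTwo X continuityEq j = prolongCoeff X 0 (1, 0) j + prolongCoeff X 1 (0, 1) j := by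
  have hx (i : Fin 2) : partialX i continuityEq j = 0 := by simp [partialX, continuityEq]
  have hu (β : Fin 4) (J : ℕ × ℕ) : partialU β J continuityEq j =
      (if β = 0 ∧ J = (1, 0) then 1 else 0) + if β = 1 ∧ J = (0, 1) then 1 else 0 := by
    rw [← partialU_coord (j := j) 0 β (1, 0), ← partialU_coord (j := j) 1 β (0, 1)]
    exact partialU_add (jetDifferentiableAt_coord _ _) (jetDifferentiableAt_coord _ _) β J
  simp [prolongTwo, hx, hu, Fin.sum_univ_four, indicesTwo]

theorem prolongTwo_momentumEq (ν k : ℝ) (X : Total → Total) (j : Jet) :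
    prolongTwo X (momentumEq ν k) j =
      prolongCoeff X 0 (0, 0) j * j.2 0 (1, 0) + j.2 0 (0, 0) * prolongCoeff X 0 (1, 0) j +
      prolongCoeff X 1 (0, 0) j * j.2 1 (0, 1) + j.2 1 (0, 0) * prolongCoeff X 1 (0, 1) j -
      (prolongCoeff X 2 (0, 0) j * j.2 2 (1, 0) + j.2 2 (0, 0) * prolongCoeff X 2 (1, 0) j +
        ν * prolongCoeff X 0 (0, 2) j +
        ν / k * (prolongCoeff X 2 (0, 0) j - prolongCoeff X 0 (0, 0) j)) := by
  have hx (i : Fin 2) : partialX i (momentumEq ν k) j = 0 := by simp [partialX, momentumEq]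
  have affine (a b t : ℝ) : deriv (fun s : ℝ => a * s + b) t = a := by simp
  have h0 : partialU 0 (0, 0) (momentumEq ν k) j = j.2 0 (1, 0) + ν / k := by
    rw [partialU, ← affine (j.2 0 (1, 0) + ν / k) (momentumEq ν k j -
      (j.2 0 (1, 0) + ν / k) * j.2 0 (0, 0))]
    congr 1
    funext s
    simp [momentumEq]
    ring
  have h2 : partialU 2 (0, 0) (momentumEq ν k) j = -(j.2 2 (1, 0) + ν / k) := by
    rw [partialU, ← affine (-(j.2 2 (1, 0) + ν / k)) (momentumEq ν k j +
      (j.2 2 (1, 0) + ν / k) * j.2 2 (0, 0))]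
    congr 1
    funext s
    simp [momentumEq]
    ring
  rw [prolongTwo]
  simp only [Fin.sum_univ_four, indicesTwo]
  repeat rw [Finset.sum_insert (by decide)]
  simp only [h0, h2, hx, Finset.sum_singleton]
  simp [partialU, momentumEq]
  ring

theorem prolongTwo_heatEq (α : ℝ) (X : Total → Total) (j : Jet) :
    prolongTwo X (heatEq α) j =
      prolongCoeff X 0 (0, 0) j * j.2 3 (1, 0) + j.2 0 (0, 0) * prolongCoeff X 3 (1, 0) j +
      prolongCoeff X 1 (0, 0) j * j.2 3 (0, 1) + j.2 1 (0, 0) * prolongCoeff X 3 (0, 1) j -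
      α * prolongCoeff X 3 (0, 2) j := by
  have hx (i : Fin 2) : partialX i (heatEq α) j = 0 := by simp [partialX, heatEq]
  simp [prolongTwo, hx, Fin.sum_univ_four, indicesTwo, partialU, heatEq,
    Function.update_apply]
  ring

theorem prolongCoeff_zero (X : Total → Total) (β : Fin 4) (j : Jet) :
    prolongCoeff X β (0, 0) j = (X j.point).2 β := by
  have h : totalDMulti (0, 0) (characteristic X β) = characteristic X β := rfl
  have e (i : Fin 2) : ((0, 0) : ℕ × ℕ) + unitIndex i = unitIndex i := zero_add _
  simp [prolongCoeff, h, characteristic, e]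

/-! ### Jets of the prolonged system over a given point -/

/-- The jet over `z` with free coordinates `U_x = a`, `U_y = b`, `V_x = c`, `P_x = p`, `P_y = q`,
`T_x = r`, `T_y = s`, `U_xy = m`, `P_yy = n`. The coordinates `V_y`, `V_yy`, `U_yy`, `T_yy` are
solved for from the system and the derivatives of the continuity equation, and all other
coordinates are zero. -/
noncomputable def solvedJet (ν k α : ℝ) (z : Total) (a b c p q r s m n : ℝ) : Jet :=
  (z.1, fun β J =>
    if J = (0, 0) then z.2 β
    else if J = (1, 0) then (![a, c, p, r] : Fin 4 → ℝ) β
    else if J = (0, 1) then (![b, -a, q, s] : Fin 4 → ℝ) β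
    else if J = (1, 1) then (![m, 0, 0, 0] : Fin 4 → ℝ) β
    else if J = (0, 2) then
      (![((z.2 0 - z.2 1) * a - z.2 2 * p) / ν - (z.2 2 - z.2 0) / k, -m, n,
        (z.2 0 * r + z.2 1 * s) / α] : Fin 4 → ℝ) β
    else 0)

section

variable {ν k α : ℝ} {z : Total} {a b c p q r s m n : ℝ}

theorem solvedJet_point : (solvedJet ν k α z a b c p q r s m n).point = z := rfl

/-- The free coordinates of `solvedJet` are unconstrained by the system and the derivatives of the
continuity equation, so an invariance condition is a polynomial identity in them. -/
theorem solvedJet_mem (hν : ν ≠ 0) (hk : k ≠ 0) (hα : α ≠ 0) :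
    solvedJet ν k α z a b c p q r s m n ∈ prolongedSystemJets ν k α := by
  refine ⟨⟨?_, ?_, ?_⟩, fun i => ?_⟩
  · simp [continuityEq, solvedJet]
  · simp only [momentumEq, solvedJet]
    simp
    field_simp
    ring
  · simp only [heatEq, solvedJet]
    simp
    field_simp
    ring
  · rw [totalD_continuityEq]
    fin_cases i <;> simp [solvedJet, unitIndex]

theorem baseD_zero_solvedJet (f : Total → ℝ) :
    baseD 0 f (solvedJet ν k α z a b c p q r s m n) =
      pd (eX 0) f z + (a * pd (eU 0) f z + c * pd (eU 1) f z + p * pd (eU 2) f z +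
        r * pd (eU 3) f z) := by
  simp only [baseD, solvedJet_point, Fin.sum_univ_four]
  simp [solvedJet, unitIndex]

theorem baseD_one_solvedJet (f : Total → ℝ) :
    baseD 1 f (solvedJet ν k α z a b c p q r s m n) =
      pd (eX 1) f z + (b * pd (eU 0) f z - a * pd (eU 1) f z + q * pd (eU 2) f z +
        s * pd (eU 3) f z) := by
  simp only [baseD, solvedJet_point, Fin.sum_univ_four]
  simp [solvedJet, unitIndex]
  ring

theorem baseDyy_solvedJet (f : Total → ℝ) :
    baseDyy f (solvedJet ν k α z a b c p q r s m n) =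
      baseD 1 (pd (eX 1) f) (solvedJet ν k α z a b c p q r s m n) +
      (b * baseD 1 (pd (eU 0) f) (solvedJet ν k α z a b c p q r s m n) -
        a * baseD 1 (pd (eU 1) f) (solvedJet ν k α z a b c p q r s m n) +
        q * baseD 1 (pd (eU 2) f) (solvedJet ν k α z a b c p q r s m n) +
        s * baseD 1 (pd (eU 3) f) (solvedJet ν k α z a b c p q r s m n)) +
      ((((z.2 0 - z.2 1) * a - z.2 2 * p) / ν - (z.2 2 - z.2 0) / k) * pd (eU 0) f z -
        m * pd (eU 1) f z + n * pd (eU 2) f z +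
        (z.2 0 * r + z.2 1 * s) / α * pd (eU 3) f z) := by
  have hy (γ : Fin 4) : (solvedJet ν k α z a b c p q r s m n).2 γ (0, 1) =
      (![b, -a, q, s] : Fin 4 → ℝ) γ := by simp [solvedJet]
  have hyy (γ : Fin 4) : (solvedJet ν k α z a b c p q r s m n).2 γ (0, 2) =
      (![((z.2 0 - z.2 1) * a - z.2 2 * p) / ν - (z.2 2 - z.2 0) / k, -m, n,
        (z.2 0 * r + z.2 1 * s) / α] : Fin 4 → ℝ) γ := by simp [solvedJet]
  rw [baseDyy]
  simp only [Fin.sum_univ_four, hy, hyy, solvedJet_point]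
  simp
  ring

end

/-! ### The determining equations -/

/-- The invariance conditions at the jets `solvedJet` over `W`, for smooth coefficients
`ξ ∂_x + η ∂_y + φU ∂_U + φV ∂_V + φP ∂_P + φT ∂_T`. -/
structure DeterminingEqs (ν k α : ℝ) (W : Set Total) (ξ η φU φV φP φT : Total → ℝ) : Prop where
  isOpen : IsOpen W
  smooth_ξ : ContDiffOn ℝ ∞ ξ W
  smooth_η : ContDiffOn ℝ ∞ η W
  smooth_φU : ContDiffOn ℝ ∞ φU W
  smooth_φV : ContDiffOn ℝ ∞ φV W
  smooth_φP : ContDiffOn ℝ ∞ φP W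
  smooth_φT : ContDiffOn ℝ ∞ φT W
  continuity : ∀ z ∈ W, ∀ a b c p q r s m n : ℝ, ∀ j, j = solvedJet ν k α z a b c p q r s m n →
    baseD 0 φU j - (baseD 0 ξ j * a + baseD 0 η j * b) +
      (baseD 1 φV j - (baseD 1 ξ j * c + baseD 1 η j * -a)) = 0
  momentum : ∀ z ∈ W, ∀ a b c p q r s m n : ℝ, ∀ j, j = solvedJet ν k α z a b c p q r s m n →
    φU z * a + z.2 0 * (baseD 0 φU j - (baseD 0 ξ j * a + baseD 0 η j * b)) +
      φV z * -a + z.2 1 * (baseD 1 φV j - (baseD 1 ξ j * c + baseD 1 η j * -a)) -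
      (φP z * p + z.2 2 * (baseD 0 φP j - (baseD 0 ξ j * p + baseD 0 η j * q)) +
        ν * (baseDyy φU j - (baseDyy ξ j * a + 2 * baseD 1 ξ j * m + (baseDyy η j * b +
          2 * baseD 1 η j *
            (((z.2 0 - z.2 1) * a - z.2 2 * p) / ν - (z.2 2 - z.2 0) / k)))) +
        ν / k * (φP z - φU z)) = 0
  heat : ∀ z ∈ W, ∀ a b c p q r s m n : ℝ, ∀ j, j = solvedJet ν k α z a b c p q r s m n →
    φU z * r + z.2 0 * (baseD 0 φT j - (baseD 0 ξ j * r + baseD 0 η j * s)) +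
      φV z * s + z.2 1 * (baseD 1 φT j - (baseD 1 ξ j * r + baseD 1 η j * s)) -
      α * (baseDyy φT j - (baseDyy ξ j * r + baseDyy η j * s +
          2 * baseD 1 η j * ((z.2 0 * r + z.2 1 * s) / α))) = 0

theorem IsInvariantMod.determiningEqs {ν k α : ℝ} (hν : ν ≠ 0) (hk : k ≠ 0) (hα : α ≠ 0)
    {W : Set Total} (hW : IsOpen W) {X : Total → Total} (hX : ContDiffOn ℝ ∞ X W)
    (h : IsInvariantMod ν k α (prolongedSystemJets ν k α) W X) :
    DeterminingEqs ν k α W (fun z => (X z).1 0) (fun z => (X z).1 1) (fun z => (X z).2 0)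
      (fun z => (X z).2 1) (fun z => (X z).2 2) (fun z => (X z).2 3) where
  isOpen := hW
  smooth_ξ := contDiffOn_fst hX 0
  smooth_η := contDiffOn_fst hX 1
  smooth_φU := contDiffOn_snd hX 0
  smooth_φV := contDiffOn_snd hX 1
  smooth_φP := contDiffOn_snd hX 2
  smooth_φT := contDiffOn_snd hX 3
  continuity z hz a b c p q r s m n j hj := by
    have hjW : j.point ∈ W := by rw [hj]; exact hz
    have h1 := (h j (hj ▸ solvedJet_mem hν hk hα) hjW).1
    have e1 := fun β => prolongCoeff_unitIndex hW hX hjW β 0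
    have e2 := fun β => prolongCoeff_unitIndex hW hX hjW β 1
    simp only [unitIndex, if_true, if_false, one_ne_zero, Fin.sum_univ_two] at e1 e2
    rw [prolongTwo_continuityEq, e1, e2] at h1
    rw [← h1, hj]
    simp [solvedJet]
  momentum z hz a b c p q r s m n j hj := by
    have hjW : j.point ∈ W := by rw [hj]; exact hz
    have h1 := (h j (hj ▸ solvedJet_mem hν hk hα) hjW).2.1
    have e1 := fun β => prolongCoeff_unitIndex hW hX hjW β 0
    have e2 := fun β => prolongCoeff_unitIndex hW hX hjW β 1
    have e3 := fun β => prolongCoeff_yy hW hX hjW β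
    simp only [unitIndex, if_true, if_false, one_ne_zero, Fin.sum_univ_two] at e1 e2 e3
    rw [prolongTwo_momentumEq, e1, e2, e1, e3, prolongCoeff_zero, prolongCoeff_zero,
      prolongCoeff_zero] at h1
    rw [← h1, hj]
    simp [solvedJet, Jet.point]
  heat z hz a b c p q r s m n j hj := by
    have hjW : j.point ∈ W := by rw [hj]; exact hz
    have h1 := (h j (hj ▸ solvedJet_mem hν hk hα) hjW).2.2
    have e1 := fun β => prolongCoeff_unitIndex hW hX hjW β 0
    have e2 := fun β => prolongCoeff_unitIndex hW hX hjW β 1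
    have e3 := fun β => prolongCoeff_yy hW hX hjW β
    simp only [unitIndex, if_true, if_false, one_ne_zero, Fin.sum_univ_two] at e1 e2 e3
    rw [prolongTwo_heatEq, e1, e2, e3, prolongCoeff_zero, prolongCoeff_zero] at h1
    rw [← h1, hj]
    simp [solvedJet, Jet.point]
    exact Or.inl (by ring)

/-! ### Directional derivatives on open sets -/

section Calculus

variable {W : Set Total} {f g : Total → ℝ} {z : Total}

theorem pd_congr (hW : IsOpen W) (h : ∀ z ∈ W, f z = g z) (hz : z ∈ W) (v : Total) :
    pd v f z = pd v g z := by
  rw [pd, pd, Filter.EventuallyEq.fderiv_eq (Filter.eventually_of_mem (hW.mem_nhds hz) h)]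

theorem pd_eq_zero (hW : IsOpen W) (h : ∀ z ∈ W, f z = 0) (hz : z ∈ W) (v : Total) :
    pd v f z = 0 := by
  rw [pd_congr hW h hz, pd]
  simp

theorem pd_pd (hW : IsOpen W) (hf : ContDiffOn ℝ ∞ f W) (hz : z ∈ W) (v w : Total) :
    pd v (pd w f) z = fderiv ℝ (fderiv ℝ f) z v w := by
  have hd : DifferentiableAt ℝ (fderiv ℝ f) z :=
    (((hf.contDiffAt (hW.mem_nhds hz)).fderiv_right (m := ∞) (by simp))).differentiableAt (by simp)
  change fderiv ℝ (fun y => fderiv ℝ f y w) z v = _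
  rw [fderiv_clm_apply hd (by fun_prop)]
  simp

theorem pd_comm (hW : IsOpen W) (hf : ContDiffOn ℝ ∞ f W) (hz : z ∈ W) (v w : Total) :
    pd v (pd w f) z = pd w (pd v f) z := by
  rw [pd_pd hW hf hz, pd_pd hW hf hz]
  exact (hf.contDiffAt (hW.mem_nhds hz)).isSymmSndFDerivAt
    (by simpa using (ENat.LEInfty.out : (2 : WithTop ℕ∞) ≤ ∞)) v w

/-- `f` is differentiable at `z` with derivative `d` along `v`. -/
def HasPd (v : Total) (f : Total → ℝ) (d : ℝ) (z : Total) : Prop :=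
  DifferentiableAt ℝ f z ∧ pd v f z = d

theorem hasPd_of_contDiffOn (hW : IsOpen W) (hf : ContDiffOn ℝ ∞ f W) (hz : z ∈ W) (v : Total) :
    HasPd v f (pd v f z) z :=
  ⟨differentiableAt_of_contDiffOn hW hf hz, rfl⟩

theorem HasPd.add {v : Total} {d e : ℝ} (hf : HasPd v f d z) (hg : HasPd v g e z) :
    HasPd v (fun z => f z + g z) (d + e) z :=
  ⟨hf.1.fun_add hg.1, by simp [pd, fderiv_fun_add hf.1 hg.1, ← hf.2, ← hg.2]⟩

theorem HasPd.const_mul {v : Total} {d : ℝ} (hf : HasPd v f d z) (c : ℝ) :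
    HasPd v (fun z => c * f z) (c * d) z :=
  ⟨hf.1.const_mul c, by simp [pd, fderiv_const_mul hf.1, ← hf.2]⟩

theorem HasPd.coord_mul {v : Total} {d : ℝ} (hf : HasPd v f d z) (β : Fin 4) :
    HasPd v (fun z => z.2 β * f z) (z.2 β * d + v.2 β * f z) z := by
  have hc : HasFDerivAt (fun z : Total => z.2 β)
      ((ContinuousLinearMap.proj β).comp
        (ContinuousLinearMap.snd ℝ (Fin 2 → ℝ) (Fin 4 → ℝ))) z :=
    ContinuousLinearMap.hasFDerivAt
      ((ContinuousLinearMap.proj β).comp (ContinuousLinearMap.snd ℝ (Fin 2 → ℝ) (Fin 4 → ℝ)))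
  have h := hc.fun_mul hf.1.hasFDerivAt
  refine ⟨h.differentiableAt, ?_⟩
  rw [pd, h.fderiv, ← hf.2]
  simp [pd]
  ring

theorem HasPd.eq_pd {v : Total} {d : ℝ} (hg : HasPd v g d z) (hW : IsOpen W)
    (h : ∀ z ∈ W, f z = g z) (hz : z ∈ W) : pd v f z = d :=
  (pd_congr hW h hz v).trans hg.2

end Calculus

/-! ### Solution of the determining equations -/

namespace DeterminingEqs

variable {ν k α : ℝ} {W : Set Total} {ξ η φU φV φP φT : Total → ℝ} {z : Total}

/-- The coefficients of the continuity condition as a polynomial in the first-order jets. -/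
theorem continuity_coeffs (H : DeterminingEqs ν k α W ξ η φU φV φP φT) (hz : z ∈ W) :
    (pd (eU 2) φU z = 0 ∧ pd (eU 3) φU z = 0) ∧
    (pd (eU 2) ξ z = 0 ∧ pd (eU 3) ξ z = 0) ∧ (pd (eU 2) η z = 0 ∧ pd (eU 3) η z = 0) ∧
    (pd (eU 2) φV z = 0 ∧ pd (eU 3) φV z = 0) ∧
    pd (eU 0) φV z = pd (eX 0) η z ∧ pd (eU 1) φU z = pd (eX 1) ξ z ∧
    pd (eU 0) ξ z + pd (eU 1) η z = 0 ∧ pd (eX 0) φU z + pd (eX 1) φV z = 0 := by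
  have h := fun a b c p q r s => H.continuity z hz a b c p q r s 0 0 _ rfl
  simp only [baseD_zero_solvedJet, baseD_one_solvedJet] at h
  have h0 := h 0 0 0 0 0 0 0
  have hp := h 0 0 0 1 0 0 0
  have hr := h 0 0 0 0 0 1 0
  have hq := h 0 0 0 0 1 0 0
  have hs := h 0 0 0 0 0 0 1
  have ha := h 1 0 0 0 0 0 0
  have ha' := h (-1) 0 0 0 0 0 0
  have hb := h 0 1 0 0 0 0 0
  have hc := h 0 0 1 0 0 0 0
  refine ⟨⟨?_, ?_⟩, ⟨?_, ?_⟩, ⟨?_, ?_⟩, ⟨?_, ?_⟩, ?_, ?_, ?_, ?_⟩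
  · linarith
  · linarith
  · linarith [h 1 0 0 1 0 0 0]
  · linarith [h 1 0 0 0 0 1 0]
  · linarith [h 0 1 0 1 0 0 0]
  · linarith [h 0 1 0 0 0 1 0]
  · linarith
  · linarith
  · linarith
  · linarith
  · linarith
  · linarith

/-- The coefficient of `U_xy` in the momentum condition, where `V_yy = -U_xy`. Together with the
continuity condition it shows that `ξ` depends on `x` only. -/
theorem mixed_coeffs (H : DeterminingEqs ν k α W ξ η φU φV φP φT) (hν : ν ≠ 0) (hz : z ∈ W) :
    pd (eX 1) ξ z = 0 ∧ pd (eU 0) ξ z = 0 ∧ pd (eU 1) ξ z = 0 ∧ pd (eU 1) η z = 0 ∧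
      pd (eU 1) φU z = 0 := by
  obtain ⟨-, -, -, -, -, hφU, hξη, -⟩ := H.continuity_coeffs hz
  have h := fun a b => (H.momentum z hz a b 0 0 0 0 0 1 0 _ rfl).trans
    (H.momentum z hz a b 0 0 0 0 0 0 0 _ rfl).symm
  simp only [baseDyy_solvedJet, baseD_zero_solvedJet, baseD_one_solvedJet] at h
  have key (a b : ℝ) : -pd (eU 1) φU z + a * pd (eU 1) ξ z + b * pd (eU 1) η z -
      2 * (pd (eX 1) ξ z + b * pd (eU 0) ξ z - a * pd (eU 1) ξ z) = 0 := by
    refine (mul_eq_zero.1 ?_).resolve_left hν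
    linear_combination -h a b
  have h0 := key 0 0
  have h1 := key 1 0
  have h2 := key 0 1
  refine ⟨?_, ?_, ?_, ?_, ?_⟩ <;> linarith

/-- On the jets with `U_y = 0`, only two terms of `D_y D_y φU` survive, as `φU` depends on
`x`, `y`, `U` only. -/
theorem baseDyy_φU (H : DeterminingEqs ν k α W ξ η φU φV φP φT) (hν : ν ≠ 0) (hz : z ∈ W)
    (a c p q r s m n : ℝ) :
    baseDyy φU (solvedJet ν k α z a 0 c p q r s m n) = pd (eX 1) (pd (eX 1) φU) z +
      (((z.2 0 - z.2 1) * a - z.2 2 * p) / ν - (z.2 2 - z.2 0) / k) * pd (eU 0) φU z := by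
  have hV : ∀ z ∈ W, pd (eU 1) φU z = 0 := fun z hz => (H.mixed_coeffs hν hz).2.2.2.2
  have hP : ∀ z ∈ W, pd (eU 2) φU z = 0 := fun z hz => (H.continuity_coeffs hz).1.1
  have hT : ∀ z ∈ W, pd (eU 3) φU z = 0 := fun z hz => (H.continuity_coeffs hz).1.2
  have hs := fun v => pd_comm H.isOpen H.smooth_φU hz v (eX 1)
  simp only [baseDyy_solvedJet, baseD_one_solvedJet, hs, hV z hz, hP z hz, hT z hz,
    pd_eq_zero H.isOpen hV hz, pd_eq_zero H.isOpen hP hz, pd_eq_zero H.isOpen hT hz]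
  ring

theorem baseDyy_ξ (H : DeterminingEqs ν k α W ξ η φU φV φP φT) (hν : ν ≠ 0) (hz : z ∈ W)
    (a b c p q r s m n : ℝ) :
    baseDyy ξ (solvedJet ν k α z a b c p q r s m n) = 0 := by
  have hy : ∀ z ∈ W, pd (eX 1) ξ z = 0 := fun z hz => (H.mixed_coeffs hν hz).1
  have hU : ∀ z ∈ W, pd (eU 0) ξ z = 0 := fun z hz => (H.mixed_coeffs hν hz).2.1
  have hV : ∀ z ∈ W, pd (eU 1) ξ z = 0 := fun z hz => (H.mixed_coeffs hν hz).2.2.1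
  have hP : ∀ z ∈ W, pd (eU 2) ξ z = 0 := fun z hz => (H.continuity_coeffs hz).2.1.1
  have hT : ∀ z ∈ W, pd (eU 3) ξ z = 0 := fun z hz => (H.continuity_coeffs hz).2.1.2
  simp only [baseDyy_solvedJet, baseD_one_solvedJet, hU z hz, hV z hz, hP z hz, hT z hz,
    pd_eq_zero H.isOpen hy hz, pd_eq_zero H.isOpen hU hz, pd_eq_zero H.isOpen hV hz,
    pd_eq_zero H.isOpen hP hz, pd_eq_zero H.isOpen hT hz]
  ring

/-- The coefficients in the momentum condition of monomials that do not contain `U_y`. -/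
theorem momentum_coeffs (H : DeterminingEqs ν k α W ξ η φU φV φP φT) (hν : ν ≠ 0)
    (hP : ∀ z ∈ W, z.2 2 ≠ 0) (hz : z ∈ W) :
    (pd (eX 0) η z = 0 ∧ pd (eU 0) η z = 0) ∧ (pd (eU 1) φP z = 0 ∧ pd (eU 3) φP z = 0) ∧
    φU z - φV z - (z.2 0 - z.2 1) * pd (eX 0) ξ z - z.2 2 * pd (eU 0) φP z +
      2 * pd (eX 1) η z * (z.2 0 - z.2 1) = 0 ∧
    φP z + z.2 2 * pd (eU 2) φP z =
      z.2 2 * (pd (eX 0) ξ z + pd (eU 0) φU z - 2 * pd (eX 1) η z) ∧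
    (z.2 0 - z.2 1) * pd (eX 0) φU z - z.2 2 * pd (eX 0) φP z - ν / k * (φP z - φU z) -
      ν * pd (eX 1) (pd (eX 1) φU) z +
      (pd (eU 0) φU z - 2 * pd (eX 1) η z) * (ν / k) * (z.2 2 - z.2 0) = 0 := by
  obtain ⟨⟨hUP, hUT⟩, ⟨hξP, hξT⟩, ⟨hηP, hηT⟩, ⟨hVP, hVT⟩, -⟩ := H.continuity_coeffs hz
  obtain ⟨hξy, hξU, hξV, hηV, hUV⟩ := H.mixed_coeffs hν hz
  have hc := fun a c p q r => H.continuity z hz a 0 c p q r 0 0 0 _ rfl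
  have h := fun a c p q r => H.momentum z hz a 0 c p q r 0 0 0 _ rfl
  -- On the solution set `V_y = -U_x`, so the continuity condition eliminates the `V_y` coefficient.
  have key : ∀ a c p q r : ℝ, (φU z - φV z) * a + (z.2 0 - z.2 1) *
      (pd (eX 0) φU z + a * pd (eU 0) φU z - a * pd (eX 0) ξ z) -
      φP z * p - z.2 2 * (pd (eX 0) φP z + a * pd (eU 0) φP z + c * pd (eU 1) φP z +
        p * pd (eU 2) φP z + r * pd (eU 3) φP z - p * pd (eX 0) ξ z -
        q * (pd (eX 0) η z + a * pd (eU 0) η z)) - ν / k * (φP z - φU z) -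
      ν * pd (eX 1) (pd (eX 1) φU) z - (pd (eU 0) φU z - 2 * pd (eX 1) η z) *
        ((z.2 0 - z.2 1) * a - z.2 2 * p - ν / k * (z.2 2 - z.2 0)) = 0 := by
    intro a c p q r
    have h1 := h a c p q r
    have h2 := hc a c p q r
    have h3 : ν * (((z.2 0 - z.2 1) * a - z.2 2 * p) / ν - (z.2 2 - z.2 0) / k) =
        (z.2 0 - z.2 1) * a - z.2 2 * p - ν / k * (z.2 2 - z.2 0) := by
      rw [mul_sub, mul_div_cancel₀ _ hν]
      ring
    rw [H.baseDyy_φU hν hz, H.baseDyy_ξ hν hz] at h1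
    simp only [baseD_zero_solvedJet, baseD_one_solvedJet, hUP, hUT, hξP, hξT, hηP, hηT, hVP, hVT,
      hξy, hξU, hξV, hηV, hUV] at h1 h2
    linear_combination h1 - z.2 1 * h2 + (pd (eU 0) φU z - 2 * pd (eX 1) η z) * h3
  have h0 := key 0 0 0 0 0
  have hq := key 0 0 0 1 0
  have hcc := key 0 1 0 0 0
  have hr := key 0 0 0 0 1
  have hη : z.2 2 * pd (eX 0) η z = 0 := by linarith
  have hη' : z.2 2 * pd (eU 0) η z = 0 := by linarith [key 1 0 0 0 0, key 1 0 0 1 0]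
  have hφ : z.2 2 * pd (eU 1) φP z = 0 := by linarith
  have hφ' : z.2 2 * pd (eU 3) φP z = 0 := by linarith
  refine ⟨⟨(mul_eq_zero.1 hη).resolve_left (hP z hz), (mul_eq_zero.1 hη').resolve_left (hP z hz)⟩,
    ⟨(mul_eq_zero.1 hφ).resolve_left (hP z hz), (mul_eq_zero.1 hφ').resolve_left (hP z hz)⟩,
    ?_, ?_, ?_⟩
  · linarith [key 1 0 0 0 0]
  · linarith [key 0 0 1 0 0]
  · linarith

/-- On `W` the coefficient `η` depends on `y` only. -/
theorem baseDyy_η (H : DeterminingEqs ν k α W ξ η φU φV φP φT) (hν : ν ≠ 0)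
    (hP : ∀ z ∈ W, z.2 2 ≠ 0) (hz : z ∈ W) (a b c p q r s m n : ℝ) :
    baseDyy η (solvedJet ν k α z a b c p q r s m n) = pd (eX 1) (pd (eX 1) η) z := by
  have hU : ∀ z ∈ W, pd (eU 0) η z = 0 := fun z hz => (H.momentum_coeffs hν hP hz).1.2
  have hV : ∀ z ∈ W, pd (eU 1) η z = 0 := fun z hz => (H.mixed_coeffs hν hz).2.2.2.1
  have hP : ∀ z ∈ W, pd (eU 2) η z = 0 := fun z hz => (H.continuity_coeffs hz).2.2.1.1
  have hT : ∀ z ∈ W, pd (eU 3) η z = 0 := fun z hz => (H.continuity_coeffs hz).2.2.1.2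
  have hs := fun v => pd_comm H.isOpen H.smooth_η hz v (eX 1)
  simp only [baseDyy_solvedJet, baseD_one_solvedJet, hs, hU z hz, hV z hz, hP z hz, hT z hz,
    pd_eq_zero H.isOpen hU hz, pd_eq_zero H.isOpen hV hz,
    pd_eq_zero H.isOpen hP hz, pd_eq_zero H.isOpen hT hz]
  ring

/-- The coefficients of `P_yy`, `V_yy` and `P_x` in the heat condition: `φT` does not depend on
`U`, `V`, `P`. -/
theorem heat_coeffs_second (H : DeterminingEqs ν k α W ξ η φU φV φP φT) (hν : ν ≠ 0) (hα : α ≠ 0)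
    (hP : ∀ z ∈ W, z.2 2 ≠ 0) (hz : z ∈ W) :
    pd (eU 0) φT z = 0 ∧ pd (eU 1) φT z = 0 ∧ pd (eU 2) φT z = 0 := by
  obtain ⟨-, ⟨hξP, hξT⟩, ⟨hηP, hηT⟩, -⟩ := H.continuity_coeffs hz
  obtain ⟨hξy, hξU, hξV, hηV, hUV⟩ := H.mixed_coeffs hν hz
  obtain ⟨⟨hηx, hηU⟩, -⟩ := H.momentum_coeffs hν hP hz
  have h := fun p m n => H.heat z hz 0 0 0 p 0 0 0 m n _ rfl
  simp only [H.baseDyy_ξ hν hz, H.baseDyy_η hν hP hz] at h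
  simp only [baseDyy_solvedJet, baseD_zero_solvedJet, baseD_one_solvedJet, hξP, hξT, hηP, hηT,
      hξy, hξU, hξV, hηV, hηx, hηU] at h
  have h0 := h 0 0 0
  have hφP : pd (eU 2) φT z = 0 := (mul_eq_zero.1 (by linarith [h 0 0 1] :
    α * pd (eU 2) φT z = 0)).resolve_left hα
  have hφV : pd (eU 1) φT z = 0 := (mul_eq_zero.1 (by linarith [h 0 1 0] :
    α * pd (eU 1) φT z = 0)).resolve_left hα
  have hφU : α * z.2 2 / ν * pd (eU 0) φT z = 0 := by
    linear_combination h 1 0 0 - h0 - z.2 0 * hφP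
  exact ⟨(mul_eq_zero.1 hφU).resolve_left (div_ne_zero (mul_ne_zero hα (hP z hz)) hν), hφV, hφP⟩

/-- The coefficients of the heat condition in `T_x` and `T_y`, once `φT` is known not to depend on
`U`, `V`, `P`. The second derivative `T_yy` is eliminated by the heat equation. -/
theorem heat_coeffs_first (H : DeterminingEqs ν k α W ξ η φU φV φP φT) (hν : ν ≠ 0) (hα : α ≠ 0)
    (hP : ∀ z ∈ W, z.2 2 ≠ 0) (hz : z ∈ W) :
    z.2 0 * pd (eX 0) φT z + z.2 1 * pd (eX 1) φT z - α * pd (eX 1) (pd (eX 1) φT) z = 0 ∧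
    φU z = z.2 0 * (pd (eX 0) ξ z - 2 * pd (eX 1) η z) ∧
    φV z = -(z.2 1 * pd (eX 1) η z) + 2 * α * pd (eX 1) (pd (eU 3) φT) z -
      α * pd (eX 1) (pd (eX 1) η) z ∧
    pd (eU 3) (pd (eU 3) φT) z = 0 := by
  obtain ⟨-, ⟨hξP, hξT⟩, ⟨hηP, hηT⟩, -⟩ := H.continuity_coeffs hz
  obtain ⟨hξy, hξU, hξV, hηV, hUV⟩ := H.mixed_coeffs hν hz
  obtain ⟨⟨hηx, hηU⟩, -⟩ := H.momentum_coeffs hν hP hz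
  have hU : ∀ z ∈ W, pd (eU 0) φT z = 0 := fun z hz => (H.heat_coeffs_second hν hα hP hz).1
  have hV : ∀ z ∈ W, pd (eU 1) φT z = 0 := fun z hz => (H.heat_coeffs_second hν hα hP hz).2.1
  have hP' : ∀ z ∈ W, pd (eU 2) φT z = 0 := fun z hz => (H.heat_coeffs_second hν hα hP hz).2.2
  have hs := fun v => pd_comm H.isOpen H.smooth_φT hz v (eX 1)
  have h := fun r s => H.heat z hz 0 0 0 0 0 r s 0 0 _ rfl
  simp only [H.baseDyy_ξ hν hz, H.baseDyy_η hν hP hz] at h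
  simp only [baseDyy_solvedJet, baseD_zero_solvedJet, baseD_one_solvedJet, hξP, hξT, hηP, hηT,
      hξy, hξU, hξV, hηV, hηx, hηU, hU z hz, hV z hz, hP' z hz, hs,
      pd_eq_zero H.isOpen hU hz, pd_eq_zero H.isOpen hV hz, pd_eq_zero H.isOpen hP' hz] at h
  have key (r s : ℝ) : (φU z - z.2 0 * (pd (eX 0) ξ z - 2 * pd (eX 1) η z)) * r +
      (φV z + z.2 1 * pd (eX 1) η z - 2 * α * pd (eX 1) (pd (eU 3) φT) z +
        α * pd (eX 1) (pd (eX 1) η) z) * s - α * pd (eU 3) (pd (eU 3) φT) z * s ^ 2 +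
      (z.2 0 * pd (eX 0) φT z + z.2 1 * pd (eX 1) φT z - α * pd (eX 1) (pd (eX 1) φT) z) = 0 := by
    have h1 : α * ((z.2 0 * r + z.2 1 * s) / α) = z.2 0 * r + z.2 1 * s :=
      mul_div_cancel₀ _ hα
    linear_combination h r s + (pd (eU 3) φT z - 2 * pd (eX 1) η z) * h1
  have h0 := key 0 0
  have h1 := key 1 0
  have h2 := key 0 1
  have h3 := key 0 (-1)
  refine ⟨by linarith, by linarith, by linarith, ?_⟩
  exact (mul_eq_zero.1 (by linarith : α * pd (eU 3) (pd (eU 3) φT) z = 0)).resolve_left hα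

/-- Since `φT` does not depend on `U` and `V`, the terms of the heat condition without `T_x` and
`T_y` can be separated by differentiating them with respect to `U` and `V`. -/
theorem φT_xy (H : DeterminingEqs ν k α W ξ η φU φV φP φT) (hν : ν ≠ 0) (hα : α ≠ 0)
    (hP : ∀ z ∈ W, z.2 2 ≠ 0) (hz : z ∈ W) :
    pd (eX 0) φT z = 0 ∧ pd (eX 1) φT z = 0 := by
  have hx := contDiffOn_pd H.isOpen H.smooth_φT (eX 0)
  have hy := contDiffOn_pd H.isOpen H.smooth_φT (eX 1)
  have hyy := contDiffOn_pd H.isOpen hy (eX 1)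
  have key (γ : Fin 4) (h0 : ∀ z ∈ W, pd (eU γ) φT z = 0) :
      (eU γ).2 0 * pd (eX 0) φT z + (eU γ).2 1 * pd (eX 1) φT z = 0 := by
    have h := (((hasPd_of_contDiffOn H.isOpen hx hz (eU γ)).coord_mul 0).add
      ((hasPd_of_contDiffOn H.isOpen hy hz (eU γ)).coord_mul 1)).add
      ((hasPd_of_contDiffOn H.isOpen hyy hz (eU γ)).const_mul (-α))
    have h1 := h.eq_pd H.isOpen (f := fun _ => 0) (fun z hz => by
      linear_combination -(H.heat_coeffs_first hν hα hP hz).1) hz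
    have h2 (w : Total) : ∀ z ∈ W, pd (eU γ) (pd w φT) z = 0 := fun z hz => by
      rw [pd_comm H.isOpen H.smooth_φT hz, pd_eq_zero H.isOpen h0 hz]
    rw [pd_eq_zero H.isOpen (fun _ _ => rfl) hz, h2 _ z hz, h2 _ z hz, pd_comm H.isOpen hy hz,
      pd_eq_zero H.isOpen (h2 _) hz] at h1
    linarith
  have hU := key 0 fun z hz => (H.heat_coeffs_second hν hα hP hz).1
  have hV := key 1 fun z hz => (H.heat_coeffs_second hν hα hP hz).2.1
  simp only [eU, Pi.single_apply] at hU hV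
  norm_num at hU hV
  exact ⟨hU, hV⟩

theorem pd_ξ_x (H : DeterminingEqs ν k α W ξ η φU φV φP φT) (hν : ν ≠ 0) (hz : z ∈ W) :
    pd (eX 1) (pd (eX 0) ξ) z = 0 ∧ ∀ γ, pd (eU γ) (pd (eX 0) ξ) z = 0 := by
  refine ⟨?_, fun γ => ?_⟩
  · rw [pd_comm H.isOpen H.smooth_ξ hz]
    exact pd_eq_zero H.isOpen (fun z hz => (H.mixed_coeffs hν hz).1) hz _
  · rw [pd_comm H.isOpen H.smooth_ξ hz]
    refine pd_eq_zero H.isOpen (fun z hz => ?_) hz _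
    fin_cases γ
    exacts [(H.mixed_coeffs hν hz).2.1, (H.mixed_coeffs hν hz).2.2.1,
      (H.continuity_coeffs hz).2.1.1, (H.continuity_coeffs hz).2.1.2]

theorem pd_η_y (H : DeterminingEqs ν k α W ξ η φU φV φP φT) (hν : ν ≠ 0)
    (hP : ∀ z ∈ W, z.2 2 ≠ 0) (hz : z ∈ W) :
    pd (eX 0) (pd (eX 1) η) z = 0 ∧ ∀ γ, pd (eU γ) (pd (eX 1) η) z = 0 := by
  refine ⟨?_, fun γ => ?_⟩
  · rw [pd_comm H.isOpen H.smooth_η hz]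
    exact pd_eq_zero H.isOpen (fun z hz => (H.momentum_coeffs hν hP hz).1.1) hz _
  · rw [pd_comm H.isOpen H.smooth_η hz]
    refine pd_eq_zero H.isOpen (fun z hz => ?_) hz _
    fin_cases γ
    exacts [(H.momentum_coeffs hν hP hz).1.2, (H.mixed_coeffs hν hz).2.2.2.1,
      (H.continuity_coeffs hz).2.2.1.1, (H.continuity_coeffs hz).2.2.1.2]

theorem φV_eq (H : DeterminingEqs ν k α W ξ η φU φV φP φT) (hν : ν ≠ 0) (hα : α ≠ 0)
    (hP : ∀ z ∈ W, z.2 2 ≠ 0) (hz : z ∈ W) :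
    φV z = -(z.2 1 * pd (eX 1) η z) - α * pd (eX 1) (pd (eX 1) η) z := by
  rw [(H.heat_coeffs_first hν hα hP hz).2.2.1, pd_comm H.isOpen H.smooth_φT hz,
    pd_eq_zero H.isOpen (fun z hz => (H.φT_xy hν hα hP hz).2) hz]
  ring

/-- The derivative of the expressions for `φU` and `φV` in the remaining continuity condition
`∂φU/∂x + ∂φV/∂y = 0` shows that `ξ` and `η` are affine. -/
theorem second_derivatives (H : DeterminingEqs ν k α W ξ η φU φV φP φT) (hν : ν ≠ 0) (hα : α ≠ 0)
    (hP : ∀ z ∈ W, z.2 2 ≠ 0) (hz : z ∈ W) :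
    pd (eX 0) (pd (eX 0) ξ) z = 0 ∧ pd (eX 1) (pd (eX 1) η) z = 0 := by
  have hξ := contDiffOn_pd H.isOpen H.smooth_ξ (eX 0)
  have hη := contDiffOn_pd H.isOpen H.smooth_η (eX 1)
  have hξξ := contDiffOn_pd H.isOpen hξ (eX 0)
  have hηη := contDiffOn_pd H.isOpen hη (eX 1)
  have hηηη := contDiffOn_pd H.isOpen hηη (eX 1)
  have h : ∀ z ∈ W, 0 = z.2 0 * pd (eX 0) (pd (eX 0) ξ) z +
      -1 * (z.2 1 * pd (eX 1) (pd (eX 1) η) z) +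
      -α * pd (eX 1) (pd (eX 1) (pd (eX 1) η)) z := by
    intro z hz
    have h1 := (((hasPd_of_contDiffOn H.isOpen hξ hz (eX 0)).add
      ((hasPd_of_contDiffOn H.isOpen hη hz (eX 0)).const_mul (-2))).coord_mul 0).eq_pd H.isOpen
      (f := φU) (fun z hz => by rw [(H.heat_coeffs_first hν hα hP hz).2.1]; ring) hz
    have h2 := ((((hasPd_of_contDiffOn H.isOpen hη hz (eX 1)).coord_mul 1).const_mul (-1)).add
      ((hasPd_of_contDiffOn H.isOpen hηη hz (eX 1)).const_mul (-α))).eq_pd H.isOpen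
      (f := φV) (fun z hz => by rw [H.φV_eq hν hα hP hz]; ring) hz
    have h3 := (H.continuity_coeffs hz).2.2.2.2.2.2.2
    rw [h1, h2, (H.pd_η_y hν hP hz).1] at h3
    simp only [eX, Pi.zero_apply] at h3 ⊢
    linear_combination -h3
  have key (γ : Fin 4) : (eU γ).2 0 * pd (eX 0) (pd (eX 0) ξ) z -
      (eU γ).2 1 * pd (eX 1) (pd (eX 1) η) z = 0 := by
    have h1 := ((((hasPd_of_contDiffOn H.isOpen hξξ hz (eU γ)).coord_mul 0).add
      (((hasPd_of_contDiffOn H.isOpen hηη hz (eU γ)).coord_mul 1).const_mul (-1))).add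
      ((hasPd_of_contDiffOn H.isOpen hηηη hz (eU γ)).const_mul (-α))).eq_pd H.isOpen
      (f := fun _ => 0) h hz
    have hηη0 : ∀ z ∈ W, pd (eU γ) (pd (eX 1) (pd (eX 1) η)) z = 0 := fun z hz => by
      rw [pd_comm H.isOpen hη hz]
      exact pd_eq_zero H.isOpen (fun z hz => (H.pd_η_y hν hP hz).2 γ) hz _
    rw [pd_eq_zero H.isOpen (fun _ _ => rfl) hz, pd_comm H.isOpen hξ hz,
      pd_eq_zero H.isOpen (fun z hz => (H.pd_ξ_x hν hz).2 γ) hz, hηη0 z hz,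
      pd_comm H.isOpen hηη hz, pd_eq_zero H.isOpen hηη0 hz] at h1
    linarith
  have hU := key 0
  have hV := key 1
  simp only [eU, Pi.single_apply] at hU hV
  norm_num at hU hV
  exact ⟨hU, hV⟩

/-- The scaling part of the field vanishes: `ξ` and `η` are locally constant, and the coefficients
of `∂_U`, `∂_V`, `∂_P` are zero. -/
theorem scaling_eq_zero (H : DeterminingEqs ν k α W ξ η φU φV φP φT) (hν : ν ≠ 0) (hk : k ≠ 0)
    (hα : α ≠ 0) (hP : ∀ z ∈ W, z.2 2 ≠ 0) :
    ∀ z ∈ W, pd (eX 0) ξ z = 0 ∧ pd (eX 1) η z = 0 ∧ φU z = 0 ∧ φV z = 0 ∧ φP z = 0 := by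
  have hξ := contDiffOn_pd H.isOpen H.smooth_ξ (eX 0)
  have hη := contDiffOn_pd H.isOpen H.smooth_η (eX 1)
  have hφx := contDiffOn_pd H.isOpen H.smooth_φP (eX 0)
  have hφU := contDiffOn_pd H.isOpen H.smooth_φP (eU 0)
  have hφP := contDiffOn_pd H.isOpen H.smooth_φP (eU 2)
  have hm : ν / k ≠ 0 := div_ne_zero hν hk
  have pdU {z : Total} (hz : z ∈ W) (v : Total) :
      pd v φU z = z.2 0 * (pd v (pd (eX 0) ξ) z - 2 * pd v (pd (eX 1) η) z) +
        v.2 0 * (pd (eX 0) ξ z - 2 * pd (eX 1) η z) := by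
    rw [(((hasPd_of_contDiffOn H.isOpen hξ hz v).add
      ((hasPd_of_contDiffOn H.isOpen hη hz v).const_mul (-2))).coord_mul 0).eq_pd H.isOpen
      (f := φU) (fun z hz => by rw [(H.heat_coeffs_first hν hα hP hz).2.1]; ring) hz]
    ring
  have φU_x : ∀ z ∈ W, pd (eX 0) φU z = 0 := fun z hz => by
    rw [pdU hz, (H.second_derivatives hν hα hP hz).1, (H.pd_η_y hν hP hz).1]
    simp [eX]
  have φU_y : ∀ z ∈ W, pd (eX 1) φU z = 0 := fun z hz => by
    rw [pdU hz, (H.second_derivatives hν hα hP hz).2, (H.pd_ξ_x hν hz).1]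
    simp [eX]
  have φU_U : ∀ z ∈ W, pd (eU 0) φU z = pd (eX 0) ξ z - 2 * pd (eX 1) η z := fun z hz => by
    rw [pdU hz, (H.pd_ξ_x hν hz).2, (H.pd_η_y hν hP hz).2]
    simp [eU]
  have φV_eq : ∀ z ∈ W, φV z = -(z.2 1 * pd (eX 1) η z) := fun z hz => by
    rw [H.φV_eq hν hα hP hz, (H.second_derivatives hν hα hP hz).2]
    ring
  -- The coefficient of `U_x` in the momentum condition, differentiated with respect to `V`.
  have hAB : ∀ z ∈ W, pd (eX 0) ξ z = pd (eX 1) η z := fun z hz => by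
    have h1 := ((((hasPd_of_contDiffOn H.isOpen hξ hz (eU 1)).add
      ((hasPd_of_contDiffOn H.isOpen hη hz (eU 1)).const_mul (-1))).coord_mul 1).add
      (((hasPd_of_contDiffOn H.isOpen hφU hz (eU 1)).coord_mul 2).const_mul (-1))).eq_pd H.isOpen
      (f := fun _ => 0) (fun z hz => by
        have := (H.momentum_coeffs hν hP hz).2.2.1
        rw [(H.heat_coeffs_first hν hα hP hz).2.1, φV_eq z hz] at this
        linear_combination -this) hz
    rw [pd_eq_zero H.isOpen (fun _ _ => rfl) hz, (H.pd_ξ_x hν hz).2, (H.pd_η_y hν hP hz).2,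
      pd_comm H.isOpen H.smooth_φP hz,
      pd_eq_zero H.isOpen (fun z hz => (H.momentum_coeffs hν hP hz).2.1.1) hz] at h1
    simp [eU] at h1
    linarith
  have hφU0 : ∀ z ∈ W, pd (eU 0) φP z = 0 := fun z hz => by
    have := (H.momentum_coeffs hν hP hz).2.2.1
    rw [(H.heat_coeffs_first hν hα hP hz).2.1, φV_eq z hz, hAB z hz] at this
    exact (mul_eq_zero.1 (by linear_combination -this : z.2 2 * pd (eU 0) φP z = 0)).resolve_left
      (hP z hz)
  -- The part of the momentum condition without derivatives, differentiated with respect to `U`.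
  have h1coef : ∀ z ∈ W, z.2 2 * pd (eX 0) φP z + ν / k * φP z =
      2 * (ν / k) * (z.2 0 * pd (eX 1) η z) + -3 * (ν / k) * (z.2 2 * pd (eX 1) η z) :=
    fun z hz => by
      have := (H.momentum_coeffs hν hP hz).2.2.2.2
      rw [φU_x z hz, pd_eq_zero H.isOpen φU_y hz, φU_U z hz,
        (H.heat_coeffs_first hν hα hP hz).2.1, hAB z hz] at this
      linear_combination -this
  have hB : ∀ z ∈ W, pd (eX 1) η z = 0 := fun z hz => by
    have e1 := ((hasPd_of_contDiffOn H.isOpen hφx hz (eU 0)).coord_mul 2).add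
      ((hasPd_of_contDiffOn H.isOpen H.smooth_φP hz (eU 0)).const_mul (ν / k))
    have e2 := (((hasPd_of_contDiffOn H.isOpen hη hz (eU 0)).coord_mul 0).const_mul
        (2 * (ν / k))).add (((hasPd_of_contDiffOn H.isOpen hη hz (eU 0)).coord_mul 2).const_mul
        (-3 * (ν / k)))
    have h1 := e1.2.symm.trans (e2.eq_pd H.isOpen h1coef hz)
    rw [pd_comm H.isOpen H.smooth_φP hz, pd_eq_zero H.isOpen hφU0 hz, hφU0 z hz,
      (H.pd_η_y hν hP hz).2] at h1
    simp [eU] at h1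
    tauto
  have hA : ∀ z ∈ W, pd (eX 0) ξ z = 0 := fun z hz => (hAB z hz).trans (hB z hz)
  have hx0 : ∀ z ∈ W, z.2 2 * pd (eX 0) φP z + ν / k * φP z = 0 := fun z hz => by
    rw [h1coef z hz, hB z hz]
    ring
  have hP0 : ∀ z ∈ W, φP z + z.2 2 * pd (eU 2) φP z = 0 := fun z hz => by
    rw [(H.momentum_coeffs hν hP hz).2.2.2.1, φU_U z hz, hA z hz, hB z hz]
    ring
  -- Cross-differentiation of the two equations for `φP`.
  have hφP0 : ∀ z ∈ W, φP z = 0 := fun z hz => by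
    have e1 := (((hasPd_of_contDiffOn H.isOpen hφx hz (eU 2)).coord_mul 2).add
      ((hasPd_of_contDiffOn H.isOpen H.smooth_φP hz (eU 2)).const_mul (ν / k))).2
    have e2 := ((hasPd_of_contDiffOn H.isOpen H.smooth_φP hz (eX 0)).add
      ((hasPd_of_contDiffOn H.isOpen hφP hz (eX 0)).coord_mul 2)).2
    rw [pd_eq_zero H.isOpen hx0 hz] at e1
    rw [pd_eq_zero H.isOpen hP0 hz, pd_comm H.isOpen H.smooth_φP hz] at e2
    rw [show (eU 2).2 2 = 1 by simp [eU]] at e1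
    rw [show (eX 0).2 2 = 0 from rfl] at e2
    have e3 : ν / k * pd (eU 2) φP z = 0 := by linarith
    have := hP0 z hz
    rw [(mul_eq_zero.1 e3).resolve_left hm] at this
    linarith
  intro z hz
  refine ⟨hA z hz, hB z hz, ?_, ?_, hφP0 z hz⟩
  · rw [(H.heat_coeffs_first hν hα hP hz).2.1, hA z hz, hB z hz]
    ring
  · rw [φV_eq z hz, hB z hz]
    ring

end DeterminingEqs

/-! ### Globalization -/

theorem pd_eq_sum (f : Total → ℝ) (z v : Total) : pd v f z =
    ∑ i : Fin 2, v.1 i * pd (eX i) f z + ∑ γ : Fin 4, v.2 γ * pd (eU γ) f z := by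
  have h : v = ∑ i : Fin 2, v.1 i • eX i + ∑ γ : Fin 4, v.2 γ • eU γ := by
    refine Prod.ext (funext fun i => ?_) (funext fun γ => ?_)
    · fin_cases i <;> simp [eX, eU, Fin.sum_univ_four]
    · fin_cases γ <;> simp [eX, eU, Fin.sum_univ_four]
  conv_lhs => rw [pd, h]
  simp [pd]

theorem exists_eq_const {Ω : Set Total} (hΩ : IsOpen Ω) (hc : IsPreconnected Ω) {f : Total → ℝ}
    (hf : ContDiffOn ℝ ∞ f Ω) (hx : ∀ z ∈ Ω, ∀ i, pd (eX i) f z = 0)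
    (hu : ∀ z ∈ Ω, ∀ γ, pd (eU γ) f z = 0) : ∃ c, ∀ z ∈ Ω, f z = c := by
  refine hΩ.exists_is_const_of_fderiv_eq_zero hc (hf.differentiableOn (by simp)) fun z hz => ?_
  refine ContinuousLinearMap.ext fun v => (pd_eq_sum f z v).trans ?_
  simp [hx z hz, hu z hz]

/-- The determining equations are solved where `P ≠ 0`, since `P` has to be cancelled. This set need
not be connected, but it is dense, so the resulting identities extend to `Ω` by continuity. -/
theorem subset_closure_inter_ne_zero {Ω : Set Total} (hΩ : IsOpen Ω) :
    Ω ⊆ closure (Ω ∩ {z | z.2 2 ≠ 0}) := by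
  refine Dense.open_subset_closure_inter ?_ hΩ
  exact (dense_compl_singleton (0 : ℝ)).preimage
    ((isOpenMap_eval (X := fun _ : Fin 4 => ℝ) 2).comp isOpenMap_snd)

theorem eq_zero_of_eq_zero_inter {Ω : Set Total} (hΩ : IsOpen Ω) {f : Total → ℝ}
    (hf : ContDiffOn ℝ ∞ f Ω) (h : ∀ z ∈ Ω ∩ {z | z.2 2 ≠ 0}, f z = 0) : ∀ z ∈ Ω, f z = 0 :=
  Set.EqOn.of_subset_closure (g := fun _ => (0 : ℝ)) h hf.continuousOn continuousOn_const
    Set.inter_subset_left (subset_closure_inter_ne_zero hΩ)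

variable {Ω : TopologicalSpace.Opens Total}

theorem generatorOn_apply (i : Fin 4) {z : Total} (hz : z ∈ Ω) :
    (generatorOn Ω i).1 z = generator i z :=
  Set.indicator_of_mem (s := (Ω : Set Total)) hz _

theorem sum_generatorOn_apply (c : Fin 4 → ℝ) {z : Total} (hz : z ∈ Ω) :
    (∑ i, c i • generatorOn Ω i : VectorFields Ω).1 z =
      (![c 0, c 1], ![0, 0, 0, c 2 + c 3 * z.2 3]) := by
  have h : (∑ i, c i • generatorOn Ω i : VectorFields Ω).1 z = ∑ i, c i • generator i z := by
    simp [Fin.sum_univ_four, ← generatorOn_apply _ hz]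
  rw [h]
  refine Prod.ext (funext fun i => ?_) (funext fun β => ?_)
  · fin_cases i <;> simp [generator, Fin.sum_univ_four]
  · fin_cases β <;> simp [generator, Fin.sum_univ_four]

/-- Each symmetry is a combination of the generators. The identities for the derivatives of the
coefficients hold on the dense set `P ≠ 0`, hence on `Ω`, where connectedness makes `ξ`, `η`,
`∂φT/∂T` and then `φT - T ∂φT/∂T` constant. -/
theorem exists_eq_sum_of_isInvariantMod {ν k α : ℝ} (hν : ν ≠ 0) (hk : k ≠ 0) (hα : α ≠ 0)
    (hΩ : IsPreconnected (Ω : Set Total)) (X : VectorFields Ω)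
    (h : IsInvariantMod ν k α (prolongedSystemJets ν k α) Ω X.1) :
    ∃ c : Fin 4 → ℝ, X = ∑ i, c i • generatorOn Ω i := by
  have hO : IsOpen (Ω : Set Total) := Ω.isOpen
  set W : Set Total := (Ω : Set Total) ∩ {z | z.2 2 ≠ 0} with hWdef
  have hW : IsOpen W := hO.inter
    (isOpen_compl_singleton.preimage ((continuous_apply 2).comp continuous_snd))
  have hP : ∀ z ∈ W, z.2 2 ≠ 0 := fun z hz => hz.2
  have H := IsInvariantMod.determiningEqs hν hk hα hW (X.2.1.mono Set.inter_subset_left)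
    fun j hj hjW => h j hj hjW.1
  have s1 := contDiffOn_fst X.2.1
  have s2 := contDiffOn_snd X.2.1
  have ext {f : Total → ℝ} (hf : ContDiffOn ℝ ∞ f Ω) (h : ∀ z ∈ W, f z = 0) :
      ∀ z ∈ (Ω : Set Total), f z = 0 := eq_zero_of_eq_zero_inter hO hf h
  have hsc := H.scaling_eq_zero hν hk hα hP
  obtain ⟨c0, hc0⟩ := exists_eq_const hO hΩ (s1 0)
    (fun z hz i => ext (contDiffOn_pd hO (s1 0) (eX i)) (fun z hz => by
      fin_cases i
      exacts [(hsc z hz).1, (H.mixed_coeffs hν hz).1]) z hz)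
    (fun z hz γ => ext (contDiffOn_pd hO (s1 0) (eU γ)) (fun z hz => by
      fin_cases γ
      exacts [(H.mixed_coeffs hν hz).2.1, (H.mixed_coeffs hν hz).2.2.1,
        (H.continuity_coeffs hz).2.1.1, (H.continuity_coeffs hz).2.1.2]) z hz)
  obtain ⟨c1, hc1⟩ := exists_eq_const hO hΩ (s1 1)
    (fun z hz i => ext (contDiffOn_pd hO (s1 1) (eX i)) (fun z hz => by
      fin_cases i
      exacts [(H.momentum_coeffs hν hP hz).1.1, (hsc z hz).2.1]) z hz)
    (fun z hz γ => ext (contDiffOn_pd hO (s1 1) (eU γ)) (fun z hz => by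
      fin_cases γ
      exacts [(H.momentum_coeffs hν hP hz).1.2, (H.mixed_coeffs hν hz).2.2.2.1,
        (H.continuity_coeffs hz).2.2.1.1, (H.continuity_coeffs hz).2.2.1.2]) z hz)
  have hU := ext (s2 0) fun z hz => (hsc z hz).2.2.1
  have hV := ext (s2 1) fun z hz => (hsc z hz).2.2.2.1
  have hPz := ext (s2 2) fun z hz => (hsc z hz).2.2.2.2
  have hTx (i : Fin 2) := ext (contDiffOn_pd hO (s2 3) (eX i)) fun z hz => by
    fin_cases i
    exacts [(H.φT_xy hν hα hP hz).1, (H.φT_xy hν hα hP hz).2]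
  have hTU := ext (contDiffOn_pd hO (s2 3) (eU 0))
    fun z hz => (H.heat_coeffs_second hν hα hP hz).1
  have hTV := ext (contDiffOn_pd hO (s2 3) (eU 1))
    fun z hz => (H.heat_coeffs_second hν hα hP hz).2.1
  have hTP := ext (contDiffOn_pd hO (s2 3) (eU 2))
    fun z hz => (H.heat_coeffs_second hν hα hP hz).2.2
  have hTT := ext (contDiffOn_pd hO (contDiffOn_pd hO (s2 3) (eU 3)) (eU 3))
    fun z hz => (H.heat_coeffs_first hν hα hP hz).2.2.2
  obtain ⟨c3, hc3⟩ := exists_eq_const hO hΩ (contDiffOn_pd hO (s2 3) (eU 3))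
    (fun z hz i => by
      rw [pd_comm hO (s2 3) hz]
      exact pd_eq_zero hO (hTx i) hz _)
    (fun z hz γ => by
      rcases eq_or_ne γ 3 with rfl | hγ
      · exact hTT z hz
      · rw [pd_comm hO (s2 3) hz]
        refine pd_eq_zero hO (fun z hz => ?_) hz _
        fin_cases γ
        exacts [hTU z hz, hTV z hz, hTP z hz, absurd rfl hγ])
  have hpd (z : Total) (hz : z ∈ (Ω : Set Total)) (v : Total) :
      pd v (fun z => (X.1 z).2 3 + z.2 3 * -c3) z = pd v (fun z => (X.1 z).2 3) z - v.2 3 * c3 := by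
    have hconst : HasPd v (fun _ => -c3) 0 z := ⟨by fun_prop, by simp [pd]⟩
    rw [((hasPd_of_contDiffOn hO (s2 3) hz v).add (hconst.coord_mul 3)).2]
    ring
  obtain ⟨c2, hc2⟩ := exists_eq_const (f := fun z => (X.1 z).2 3 + z.2 3 * -c3) hO hΩ
    ((s2 3).add ((contDiffOn_pi.1 contDiff_snd.contDiffOn 3).mul contDiffOn_const))
    (fun z hz i => by
      rw [hpd z hz, hTx i z hz]
      simp [eX])
    (fun z hz γ => by
      rw [hpd z hz]
      fin_cases γ
      · simpa [eU] using hTU z hz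
      · simpa [eU] using hTV z hz
      · simpa [eU] using hTP z hz
      · simpa [eU, sub_eq_zero] using hc3 z hz)
  refine ⟨![c0, c1, c2, c3], field_ext_on fun z hz => ?_⟩
  rw [sum_generatorOn_apply _ hz]
  refine Prod.ext (funext fun i => ?_) (funext fun β => ?_)
  · fin_cases i
    exacts [hc0 z hz, hc1 z hz]
  · fin_cases β
    · exact hU z hz
    · exact hV z hz
    · exact hPz z hz
    · have := hc2 z hz
      simp
      linarith

/-! ### The generated fields are symmetries -/

theorem baseD_of_eq_const {f : Total → ℝ} {c : ℝ} (h : ∀ z ∈ Ω, f z = c) {j : Jet}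
    (hj : j.point ∈ Ω) (i : Fin 2) : baseD i f j = 0 := by
  have h0 (v : Total) : pd v f j.point = 0 := by
    rw [pd_congr Ω.isOpen h hj, pd]
    simp
  simp [baseD, h0]

theorem baseDyy_of_eq_const {f : Total → ℝ} {c : ℝ} (h : ∀ z ∈ Ω, f z = c) {j : Jet}
    (hj : j.point ∈ Ω) : baseDyy f j = 0 := by
  have h0 (v : Total) : ∀ z ∈ Ω, pd v f z = 0 := fun z hz => by
    rw [pd_congr Ω.isOpen h hz, pd]
    simp
  simp [baseDyy, baseD_of_eq_const (h0 _) hj, h0 _ _ hj]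

theorem pd_of_eq_affine {f : Total → ℝ} {c d : ℝ} (h : ∀ z ∈ Ω, f z = c + d * z.2 3) (v : Total) :
    ∀ z ∈ Ω, pd v f z = d * v.2 3 := fun z hz => by
  have h1 : HasPd v (fun _ => c) 0 z := ⟨by fun_prop, by simp [pd]⟩
  have h2 : HasPd v (fun _ => d) 0 z := ⟨by fun_prop, by simp [pd]⟩
  rw [(h1.add (h2.coord_mul 3)).eq_pd Ω.isOpen (fun z hz => by rw [h z hz]; ring) hz]
  ring

theorem baseD_of_eq_affine {f : Total → ℝ} {c d : ℝ} (h : ∀ z ∈ Ω, f z = c + d * z.2 3) {j : Jet}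
    (hj : j.point ∈ Ω) (i : Fin 2) : baseD i f j = d * j.2 3 (unitIndex i) := by
  simp [baseD, pd_of_eq_affine h _ _ hj, Fin.sum_univ_four, eX, eU, mul_comm]

theorem baseDyy_of_eq_affine {f : Total → ℝ} {c d : ℝ} (h : ∀ z ∈ Ω, f z = c + d * z.2 3)
    {j : Jet} (hj : j.point ∈ Ω) : baseDyy f j = d * j.2 3 (0, 2) := by
  simp [baseDyy, baseD_of_eq_const (pd_of_eq_affine h _) hj, pd_of_eq_affine h _ _ hj,
    Fin.sum_univ_four, eU, mul_comm]

/-- The prolonged field annihilates the first two equations identically, and multiplies the left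
side of the heat equation by the coefficient of `T ∂_T`. -/
theorem isInvariantMod_sum_generatorOn (ν k α : ℝ) (c : Fin 4 → ℝ) :
    IsInvariantMod ν k α (systemJets ν k α) Ω
      (∑ i, c i • generatorOn Ω i : VectorFields Ω).1 := by
  intro j hj hjΩ
  set X : VectorFields Ω := ∑ i, c i • generatorOn Ω i
  have hX : ∀ z ∈ Ω, X.1 z = (![c 0, c 1], ![0, 0, 0, c 2 + c 3 * z.2 3]) :=
    fun z hz => sum_generatorOn_apply c hz
  have h0 : ∀ z ∈ Ω, (X.1 z).1 0 = c 0 := fun z hz => by rw [hX z hz]; rfl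
  have h1 : ∀ z ∈ Ω, (X.1 z).1 1 = c 1 := fun z hz => by rw [hX z hz]; rfl
  have hU : ∀ z ∈ Ω, (X.1 z).2 0 = 0 := fun z hz => by rw [hX z hz]; rfl
  have hV : ∀ z ∈ Ω, (X.1 z).2 1 = 0 := fun z hz => by rw [hX z hz]; rfl
  have hP : ∀ z ∈ Ω, (X.1 z).2 2 = 0 := fun z hz => by rw [hX z hz]; rfl
  have hT : ∀ z ∈ Ω, (X.1 z).2 3 = c 2 + c 3 * z.2 3 := fun z hz => by rw [hX z hz]; rfl
  have e1 := fun β => prolongCoeff_unitIndex Ω.isOpen X.2.1 hjΩ β 0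
  have e2 := fun β => prolongCoeff_unitIndex Ω.isOpen X.2.1 hjΩ β 1
  have e3 := fun β => prolongCoeff_yy Ω.isOpen X.2.1 hjΩ β
  simp only [Fin.sum_univ_two, baseD_of_eq_const h0 hjΩ, baseD_of_eq_const h1 hjΩ,
    baseDyy_of_eq_const h0 hjΩ, baseDyy_of_eq_const h1 hjΩ, zero_mul, mul_zero, add_zero,
    sub_zero] at e1 e2 e3
  rw [show unitIndex 0 = (1, 0) from rfl] at e1
  rw [show unitIndex 1 = (0, 1) from rfl] at e2
  refine ⟨?_, ?_, ?_⟩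
  · rw [prolongTwo_continuityEq, e1, e2, baseD_of_eq_const hU hjΩ, baseD_of_eq_const hV hjΩ,
      add_zero]
  · simp only [prolongTwo_momentumEq, e1, e2, e3, prolongCoeff_zero, hU _ hjΩ, hV _ hjΩ, hP _ hjΩ,
      baseD_of_eq_const hU hjΩ, baseD_of_eq_const hV hjΩ, baseD_of_eq_const hP hjΩ,
      baseDyy_of_eq_const hU hjΩ]
    ring
  · have hheat := hj.2.2
    rw [heatEq] at hheat
    simp only [prolongTwo_heatEq, e1, e2, e3, prolongCoeff_zero, hU _ hjΩ, hV _ hjΩ,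
      baseD_of_eq_affine hT hjΩ, baseDyy_of_eq_affine hT hjΩ]
    simp only [unitIndex, if_true, if_false, one_ne_zero]
    linear_combination c 3 * hheat

/-! ### The Lie algebra -/

theorem bracket_generatorOn_apply (i j : Fin 4) {z : Total} (hz : z ∈ Ω) :
    (⁅generatorOn Ω i, generatorOn Ω j⁆ : VectorFields Ω).1 z =
      VectorField.lieBracket ℝ (generator i) (generator j) z := by
  have h (i : Fin 4) : (generatorOn Ω i).1 =ᶠ[nhds z] generator i :=
    Filter.eventually_of_mem (Ω.isOpen.mem_nhds hz) fun _ hw => generatorOn_apply i hw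
  rw [bracket_apply _ _ hz, (h i).lieBracket_vectorField_eq (h j)]

theorem fderiv_generator_of_ne {i : Fin 4} (hi : i ≠ 3) (z : Total) :
    fderiv ℝ (generator i) z = 0 := by
  fin_cases i
  · exact fderiv_const_apply _
  · exact fderiv_const_apply _
  · exact fderiv_const_apply _
  · exact absurd rfl hi

theorem fderiv_generator_three (z v : Total) :
    fderiv ℝ (generator 3) z v = (0, Pi.single 3 (v.2 3)) := by
  let L : Total →L[ℝ] Total := (0 : Total →L[ℝ] (Fin 2 → ℝ)).prod
    ((ContinuousLinearMap.single ℝ (fun _ : Fin 4 => ℝ) 3).comp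
      ((ContinuousLinearMap.proj 3).comp (ContinuousLinearMap.snd ℝ (Fin 2 → ℝ) (Fin 4 → ℝ))))
  have h : generator 3 = L := rfl
  rw [h, L.fderiv]
  rfl

theorem bracket_generatorOn_two_three :
    ⁅generatorOn Ω 2, generatorOn Ω 3⁆ = generatorOn Ω 2 :=
  field_ext_on fun z hz => by
    rw [bracket_generatorOn_apply _ _ hz, generatorOn_apply _ hz, VectorField.lieBracket,
      fderiv_generator_three, fderiv_generator_of_ne (by decide)]
    simp [generator]

theorem bracket_generatorOn_eq_zero {i j : Fin 4} (hij : i < j) (h : (i, j) ≠ (2, 3)) :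
    ⁅generatorOn Ω i, generatorOn Ω j⁆ = 0 :=
  field_ext_on fun z hz => by
    have hi : i ≠ 3 := fun hi => by subst hi; revert hij; decide +revert
    rw [bracket_generatorOn_apply _ _ hz, VectorField.lieBracket, fderiv_generator_of_ne hi]
    by_cases hj : j = 3
    · subst hj
      have h2 : (generator i z).2 3 = 0 := by
        fin_cases i
        · simp [generator]
        · simp [generator]
        · exact absurd rfl h
        · exact absurd rfl hi
      rw [fderiv_generator_three, h2]
      simp
    · rw [fderiv_generator_of_ne hj]
      simp

theorem bracket_generatorOn_mem_span (i j : Fin 4) :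
    ⁅generatorOn Ω i, generatorOn Ω j⁆ ∈ Submodule.span ℝ (Set.range (generatorOn Ω)) := by
  have key : ∀ i j : Fin 4, i < j →
      ⁅generatorOn Ω i, generatorOn Ω j⁆ ∈ Submodule.span ℝ (Set.range (generatorOn Ω)) := by
    intro i j hij
    by_cases h : (i, j) = (2, 3)
    · obtain ⟨rfl, rfl⟩ := Prod.mk.inj h
      rw [bracket_generatorOn_two_three]
      exact Submodule.subset_span ⟨2, rfl⟩
    · rw [bracket_generatorOn_eq_zero hij h]
      exact Submodule.zero_mem _
  rcases lt_trichotomy i j with h | rfl | h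
  · exact key i j h
  · rw [lie_self]
    exact Submodule.zero_mem _
  · rw [← lie_skew]
    exact Submodule.neg_mem _ (key j i h)

/-- The Lie algebra spanned by `∂_x`, `∂_y`, `∂_T` and `T ∂_T` on `Ω`. -/
noncomputable def generatedAlgebra (Ω : TopologicalSpace.Opens Total) :
    LieSubalgebra ℝ (VectorFields Ω) where
  __ := Submodule.span ℝ (Set.range (generatorOn Ω))
  lie_mem' {X Y} hX hY := by
    change X ∈ Submodule.span ℝ (Set.range (generatorOn Ω)) at hX
    change Y ∈ Submodule.span ℝ (Set.range (generatorOn Ω)) at hY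
    change ⁅X, Y⁆ ∈ Submodule.span ℝ (Set.range (generatorOn Ω))
    obtain ⟨c, rfl⟩ := (Submodule.mem_span_range_iff_exists_fun ℝ).1 hX
    obtain ⟨d, rfl⟩ := (Submodule.mem_span_range_iff_exists_fun ℝ).1 hY
    simp only [sum_lie, lie_sum, smul_lie, lie_smul]
    exact Submodule.sum_mem _ fun j _ => Submodule.smul_mem _ _ <| Submodule.sum_mem _ fun i _ =>
      Submodule.smul_mem _ _ (bracket_generatorOn_mem_span i j)

theorem mem_generatedAlgebra {X : VectorFields Ω} :
    X ∈ generatedAlgebra Ω ↔ ∃ c : Fin 4 → ℝ, X = ∑ i, c i • generatorOn Ω i := by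
  change X ∈ Submodule.span ℝ (Set.range (generatorOn Ω)) ↔ _
  rw [Submodule.mem_span_range_iff_exists_fun]
  simp only [eq_comm]

theorem linearIndependent_generatorOn (hΩ : (Ω : Set Total).Nonempty) :
    LinearIndependent ℝ (generatorOn Ω) := by
  rw [Fintype.linearIndependent_iff]
  intro c hc
  obtain ⟨z, hz⟩ := hΩ
  have h : ∀ w ∈ Ω, ((![c 0, c 1], ![0, 0, 0, c 2 + c 3 * w.2 3]) : Total) = 0 := fun w hw => by
    rw [← sum_generatorOn_apply c hw, hc]
    rfl
  have hT : ∀ w ∈ Ω, c 2 + c 3 * w.2 3 = 0 := fun w hw => congrFun (congrArg Prod.snd (h w hw)) 3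
  have h0 : c 0 = 0 := congrFun (congrArg Prod.fst (h z hz)) 0
  have h1 : c 1 = 0 := congrFun (congrArg Prod.fst (h z hz)) 1
  -- The relation `c 2 + c 3 * T = 0` holds on an open set, so its derivative in `T` vanishes.
  have h3 : c 3 = 0 := by
    have := pd_of_eq_affine (f := fun _ => 0) (fun w hw => (hT w hw).symm) (eU 3) z hz
    simpa [eU, pd] using this.symm
  have h2 : c 2 = 0 := by simpa [h3] using hT z hz
  intro i
  fin_cases i
  exacts [h0, h1, h2, h3]

end StagnationFlow

theorem mainTheorem1 (ν k α : ℝ) (hν : ν ≠ 0) (hk : k ≠ 0) (hα : α ≠ 0)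
    (Ω : TopologicalSpace.Opens StagnationFlow.Total)
    (hΩ : IsConnected (Ω : Set StagnationFlow.Total)) :
    ∃ 𝔤 : LieSubalgebra ℝ (StagnationFlow.VectorFields Ω),
      (∀ X : StagnationFlow.VectorFields Ω, X ∈ 𝔤 ↔
        StagnationFlow.IsInvariantMod ν k α (StagnationFlow.systemJets ν k α) Ω X.1) ∧
      (∀ X : StagnationFlow.VectorFields Ω, X ∈ 𝔤 ↔
        StagnationFlow.IsInvariantMod ν k α (StagnationFlow.prolongedSystemJets ν k α) Ω X.1) ∧
      Module.finrank ℝ 𝔤 = 4 ∧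
      (∃ b : Module.Basis (Fin 4) ℝ 𝔤,
        ∀ i, (b i : StagnationFlow.VectorFields Ω) = StagnationFlow.generatorOn Ω i) ∧
      ⁅StagnationFlow.generatorOn Ω 2, StagnationFlow.generatorOn Ω 3⁆ =
        StagnationFlow.generatorOn Ω 2 ∧
      (∀ i j : Fin 4, i < j → (i, j) ≠ (2, 3) →
        ⁅StagnationFlow.generatorOn Ω i, StagnationFlow.generatorOn Ω j⁆ = 0) := by
  have of_mem {X : StagnationFlow.VectorFields Ω} (hX : X ∈ StagnationFlow.generatedAlgebra Ω) :
      StagnationFlow.IsInvariantMod ν k α (StagnationFlow.systemJets ν k α) Ω X.1 := by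
    obtain ⟨c, rfl⟩ := StagnationFlow.mem_generatedAlgebra.1 hX
    exact StagnationFlow.isInvariantMod_sum_generatorOn ν k α c
  have mem_of {X : StagnationFlow.VectorFields Ω}
      (hX : StagnationFlow.IsInvariantMod ν k α (StagnationFlow.prolongedSystemJets ν k α) Ω X.1) :
      X ∈ StagnationFlow.generatedAlgebra Ω :=
    StagnationFlow.mem_generatedAlgebra.2
      (StagnationFlow.exists_eq_sum_of_isInvariantMod hν hk hα hΩ.isPreconnected X hX)
  let b : Module.Basis (Fin 4) ℝ (StagnationFlow.generatedAlgebra Ω) :=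
    Module.Basis.span (StagnationFlow.linearIndependent_generatorOn hΩ.nonempty)
  refine ⟨StagnationFlow.generatedAlgebra Ω,
    fun X => ⟨of_mem, fun h => mem_of fun j hj => h j hj.1⟩,
    fun X => ⟨fun h j hj => of_mem h j hj.1, mem_of⟩,
    by simpa using Module.finrank_eq_card_basis b, ⟨b, fun i => ?_⟩,
    StagnationFlow.bracket_generatorOn_two_three,
    fun i j hij h => StagnationFlow.bracket_generatorOn_eq_zero hij h⟩
  exact congrArg Subtype.val
    (Module.Basis.span_apply (StagnationFlow.linearIndependent_generatorOn hΩ.nonempty) i)
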